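/- Let $\mathbb{K}\in\{\mathbb{R},\mathbb{C}\}$ and consider the discrete-time descriptor system $$E x_{k+1}=A x_k+B u_k,\qquad y_k=C x_k+D u_k,\qquad k\ge 0,$$ with $E,A\in\mathbb{K}^{n\times n}$, $B\in\mathbb{K}^{n\times m}$, $C\in\mathbb{K}^{m\times n}$, $D\in\mathbb{K}^{m\times m}$. Assume that $(E,A)$ is regular (i.e. $\det(\lambda E-A)\ne 0$ for some $\lambda\in\mathbb{C}$), that $E\neq 0$, and that $(E,A)$ has index at most one (complete causality), i.e. there are invertible $S,T\in\mathbb{K}^{n\times n}$ with $SET=\mathrm{diag}(I_{r_0},N)$, $SAT=\mathrm{diag}(A_f,I_{n-r_0})$ and $N=0$. Assume further that the system is behaviorally controllable, i.e. $\operatorname{rank}[\lambda E-A,\ B]=n$ for all $\lambda\in\mathbb{C}$. Let $U,V\in\mathbb{K}^{n\times n}$ be unitary with $UEV=\begin{bmatrix}\Sigma_E&0\\0&0\end{bmatrix}$, where $\Sigma_E\in\mathbb{R}^{r\times r}$ is diagonal with positive diagonal entries (a singular value decomposition of $E$), and partition accordingly $$UAV=\begin{bmatrix}A_{11}&A_{12}\\A_{21}&A_{22}\end{bmatrix},\qquad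 UB=\begin{bmatrix}B_1\\B_2\end{bmatrix},\qquad CV=[C_1,\ C_2].$$ Then $A_{22}$ is invertible, and the associated standard state-space system $(I_r,\mathcal{A},\mathcal{B},\mathcal{C},\mathcal{D})$ with $$\mathcal{A}=\Sigma_E^{-1/2}(A_{11}-A_{12}A_{22}^{-1}A_{21})\Sigma_E^{-1/2},\quad \mathcal{B}=\Sigma_E^{-1/2}(B_1-A_{12}A_{22}^{-1}B_2),$$ $$\mathcal{C}=(C_1-C_2A_{22}^{-1}A_{21})\Sigma_E^{-1/2},\quad \mathcal{D}=D-C_2A_{22}^{-1}B_2$$ has the following properties. Let $\mathcal{T}(z)=C(zE-A)^{-1}B+D$ be the transfer function, regarded as a rational matrix function (removable singularities are filled in). 1. If (d-PR) holds, i.e. $\mathcal{T}$ is analytic in $\{|z|>1\}$ and $\mathcal{T}(z)+\mathcal{T}(z)^H\ge 0$ for all $z\in\mathbb{C}$ with $|z|>1$, then $(I_r,\mathcal{A},\mathcal{B},\mathcal{C},\mathcal{D})$ satisfies (d-iKYP): there exists $X=X^H\ge0$ in $\mathbb{K}^{r\times r}$ such that $$\begin{bmatrix}-\mathcal{A}^HX\mathcal{A}+X&\mathcal{C}^H-\mathcal{A}^HX\mathcal{B}\\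 \mathcal{C}-\mathcal{B}^HX\mathcal{A}&\mathcal{D}+\mathcal{D}^H-\mathcal{B}^HX\mathcal{B}\end{bmatrix}\ge 0.$$ 2. If (d-BR) holds, i.e. $\mathcal{T}$ is analytic in $\{|z|>1\}$ and $I_m-\mathcal{T}(z)^H\mathcal{T}(z)\ge 0$ for all $z\in\mathbb{C}$ with $|z|>1$, then $(I_r,\mathcal{A},\mathcal{B},\mathcal{C},\mathcal{D})$ satisfies (d-sKYP): there exists $X=X^H\ge0$ in $\mathbb{K}^{r\times r}$ such that $$\begin{bmatrix}-\mathcal{A}^HX\mathcal{A}+X-\mathcal{C}^H\mathcal{C}&-\mathcal{A}^HX\mathcal{B}-\mathcal{C}^H\mathcal{D}\\-\mathcal{D}^H\mathcal{C}-\mathcal{B}^HX\mathcal{A}&I_m-\mathcal{D}^H\mathcal{D}-\mathcal{B}^HX\mathcal{B}\end{bmatrix}\ge 0.$$ -/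

import Mathlib

open scoped ComplexOrder Matrix

noncomputable section

/-- The entrywise embedding of a matrix over `𝕜` (that is, over `ℝ` or `ℂ`) into the complex
matrices. For `𝕜 = ℝ` it is the usual inclusion and for `𝕜 = ℂ` it is the identity. -/
def toComplexMatrix {𝕜 : Type*} [RCLike 𝕜] {ι κ : Type*} (M : Matrix ι κ 𝕜) : Matrix ι κ ℂ :=
  M.map fun x => (RCLike.re x : ℂ) + (RCLike.im x : ℂ) * Complex.I

/-- The splitting of `n = r + s` indices into the first `r` and the last `s` ones. -/
def blockEquiv {n r s : ℕ} (h : r + s = n) : Fin r ⊕ Fin s ≃ Fin n :=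
  finSumFinEquiv.trans (finCongr h)

/-- The coefficients `(E, A, B, C, D)` of the discrete-time descriptor system
`E x_{k+1} = A x_k + B u_k`, `y_k = C x_k + D u_k` with state dimension `n` and with
`m` inputs and `m` outputs. -/
structure DescriptorSystem (𝕜 : Type*) (n m : ℕ) where
  E : Matrix (Fin n) (Fin n) 𝕜
  A : Matrix (Fin n) (Fin n) 𝕜
  B : Matrix (Fin n) (Fin m) 𝕜
  C : Matrix (Fin m) (Fin n) 𝕜
  D : Matrix (Fin m) (Fin m) 𝕜

/-- The pair `(E, A)` has index at most `ν`: it has a Weierstrass decomposition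
`(S E T, S A T) = (diag(I_r, N), diag(A_f, I_s))`, `S` and `T` invertible, whose nilpotent
part `N` satisfies `N ^ ν = 0`. -/
def HasIndexAtMost {𝕜 : Type*} [RCLike 𝕜] {n : ℕ} (E A : Matrix (Fin n) (Fin n) 𝕜) (ν : ℕ) :
    Prop :=
  ∃ (r s : ℕ) (h : r + s = n) (S T : Matrix (Fin n) (Fin n) 𝕜)
    (Af : Matrix (Fin r) (Fin r) 𝕜) (N : Matrix (Fin s) (Fin s) 𝕜),
    IsUnit S ∧ IsUnit T ∧ N ^ ν = 0 ∧
    (S * E * T).submatrix (blockEquiv h) (blockEquiv h) = Matrix.fromBlocks 1 0 0 N ∧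
    (S * A * T).submatrix (blockEquiv h) (blockEquiv h) = Matrix.fromBlocks Af 0 0 1

/-- A rational matrix function, given by its values, satisfies (d-PR): it is analytic in
`|z| > 1` and `G(z) + G(z)ᴴ ≥ 0` there. -/
def IsPositiveReal {m : ℕ} (G : ℂ → Matrix (Fin m) (Fin m) ℂ) : Prop :=
  (∀ i j, AnalyticOnNhd ℂ (fun z => G z i j) {z : ℂ | 1 < ‖z‖}) ∧
    ∀ z : ℂ, 1 < ‖z‖ → (G z + (G z)ᴴ).PosSemidef

/-- A rational matrix function, given by its values, satisfies (d-BR): it is analytic in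
`|z| > 1` and `I - G(z)ᴴ G(z) ≥ 0` there. -/
def IsBoundedReal {m : ℕ} (G : ℂ → Matrix (Fin m) (Fin m) ℂ) : Prop :=
  (∀ i j, AnalyticOnNhd ℂ (fun z => G z i j) {z : ℂ | 1 < ‖z‖}) ∧
    ∀ z : ℂ, 1 < ‖z‖ → (1 - (G z)ᴴ * G z).PosSemidef

namespace DescriptorSystem

variable {𝕜 : Type*} [RCLike 𝕜] {n m : ℕ}

/-- The complex matrix `z E - A`. -/
def pencil (S : DescriptorSystem 𝕜 n m) (z : ℂ) : Matrix (Fin n) (Fin n) ℂ :=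
  z • toComplexMatrix S.E - toComplexMatrix S.A

/-- The resolvent set `ρ(E, A)`. -/
def resolventSet (S : DescriptorSystem 𝕜 n m) : Set ℂ :=
  {z : ℂ | (S.pencil z).det ≠ 0}

/-- The pair `(E, A)` is regular. -/
def IsRegular (S : DescriptorSystem 𝕜 n m) : Prop :=
  S.resolventSet.Nonempty

/-- The standing assumption: the system is regular, `E ≠ 0`, and the system is completely
causal, that is, the pair `(E, A)` has index at most one. -/
structure StandingAssumption (S : DescriptorSystem 𝕜 n m) : Prop where
  regular : S.IsRegular
  E_ne_zero : S.E ≠ 0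
  index_le_one : HasIndexAtMost S.E S.A 1

/-- Behavioral controllability (C1): `rank [λ E - A, B] = n` for all complex `λ`. -/
def IsBehaviorallyControllable (S : DescriptorSystem 𝕜 n m) : Prop :=
  ∀ z : ℂ, (Matrix.fromCols (S.pencil z) (toComplexMatrix S.B)).rank = n

/-- The transfer function `C (z E - A)⁻¹ B + D`; meaningful for `z` in the resolvent set. -/
def transfer (S : DescriptorSystem 𝕜 n m) (z : ℂ) : Matrix (Fin m) (Fin m) ℂ :=
  toComplexMatrix S.C * (S.pencil z)⁻¹ * toComplexMatrix S.B + toComplexMatrix S.D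

/-- The system satisfies (d-PR). The transfer function is a rational function, so removable
singularities in `|z| > 1` are filled in: `G` is the (unique) analytic extension to `|z| > 1`
of the transfer function. -/
def SatisfiesDPR (S : DescriptorSystem 𝕜 n m) : Prop :=
  ∃ G : ℂ → Matrix (Fin m) (Fin m) ℂ,
    (∀ z : ℂ, 1 < ‖z‖ → z ∈ S.resolventSet → G z = S.transfer z) ∧ IsPositiveReal G

/-- The system satisfies (d-BR), with the same convention on removable singularities. -/
def SatisfiesDBR (S : DescriptorSystem 𝕜 n m) : Prop :=
  ∃ G : ℂ → Matrix (Fin m) (Fin m) ℂ,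
    (∀ z : ℂ, 1 < ‖z‖ → z ∈ S.resolventSet → G z = S.transfer z) ∧ IsBoundedReal G

/-- The Kalman-Yakubovich-Popov condition (d-iKYP) for the impedance supply rate. -/
def SatisfiesDIKYP (S : DescriptorSystem 𝕜 n m) : Prop :=
  ∃ X : Matrix (Fin n) (Fin n) 𝕜, X.PosSemidef ∧
    (Matrix.fromBlocks
      (-(S.Aᴴ * X * S.A) + S.Eᴴ * X * S.E) (S.Cᴴ - S.Aᴴ * X * S.B)
      (S.C - S.Bᴴ * X * S.A) (S.D + S.Dᴴ - S.Bᴴ * X * S.B)).PosSemidef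

/-- The Kalman-Yakubovich-Popov condition (d-sKYP) for the scattering supply rate. -/
def SatisfiesDSKYP (S : DescriptorSystem 𝕜 n m) : Prop :=
  ∃ X : Matrix (Fin n) (Fin n) 𝕜, X.PosSemidef ∧
    (Matrix.fromBlocks
      (-(S.Aᴴ * X * S.A) + S.Eᴴ * X * S.E - S.Cᴴ * S.C) (-(S.Aᴴ * X * S.B) - S.Cᴴ * S.D)
      (-(S.Dᴴ * S.C) - S.Bᴴ * X * S.A) (1 - S.Dᴴ * S.D - S.Bᴴ * X * S.B)).PosSemidef

/-- A singular value decomposition `U E V = diag(Σ_E, 0)` of `E`, with `U`, `V` unitary and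
`Σ_E = diag(σ_1, …, σ_r)`, all `σ_i` positive. -/
structure SVD (S : DescriptorSystem 𝕜 n m) (r s : ℕ) where
  dim : r + s = n
  U : Matrix (Fin n) (Fin n) 𝕜
  V : Matrix (Fin n) (Fin n) 𝕜
  U_mem : U ∈ Matrix.unitaryGroup (Fin n) 𝕜
  V_mem : V ∈ Matrix.unitaryGroup (Fin n) 𝕜
  σ : Fin r → ℝ
  σ_pos : ∀ i, 0 < σ i
  eq : (U * S.E * V).submatrix (blockEquiv dim) (blockEquiv dim) =
    Matrix.fromBlocks (Matrix.diagonal fun i => (σ i : 𝕜)) 0 0 0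

namespace SVD

variable {S : DescriptorSystem 𝕜 n m} {r s : ℕ}

/-- `U A V`, split into blocks. -/
def UAV (R : S.SVD r s) : Matrix (Fin r ⊕ Fin s) (Fin r ⊕ Fin s) 𝕜 :=
  (R.U * S.A * R.V).submatrix (blockEquiv R.dim) (blockEquiv R.dim)

def A₁₁ (R : S.SVD r s) : Matrix (Fin r) (Fin r) 𝕜 := R.UAV.toBlocks₁₁

def A₁₂ (R : S.SVD r s) : Matrix (Fin r) (Fin s) 𝕜 := R.UAV.toBlocks₁₂

def A₂₁ (R : S.SVD r s) : Matrix (Fin s) (Fin r) 𝕜 := R.UAV.toBlocks₂₁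

def A₂₂ (R : S.SVD r s) : Matrix (Fin s) (Fin s) 𝕜 := R.UAV.toBlocks₂₂

/-- The first `r` rows of `U B`. -/
def B₁ (R : S.SVD r s) : Matrix (Fin r) (Fin m) 𝕜 :=
  ((R.U * S.B).submatrix (blockEquiv R.dim) id).toRows₁

/-- The last `s` rows of `U B`. -/
def B₂ (R : S.SVD r s) : Matrix (Fin s) (Fin m) 𝕜 :=
  ((R.U * S.B).submatrix (blockEquiv R.dim) id).toRows₂

/-- The first `r` columns of `C V`. -/
def C₁ (R : S.SVD r s) : Matrix (Fin m) (Fin r) 𝕜 :=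
  ((S.C * R.V).submatrix id (blockEquiv R.dim)).toCols₁

/-- The last `s` columns of `C V`. -/
def C₂ (R : S.SVD r s) : Matrix (Fin m) (Fin s) 𝕜 :=
  ((S.C * R.V).submatrix id (blockEquiv R.dim)).toCols₂

/-- The matrix `Σ_E ^ (-1/2)`. -/
def invSqrtSigma (R : S.SVD r s) : Matrix (Fin r) (Fin r) 𝕜 :=
  Matrix.diagonal fun i => (((Real.sqrt (R.σ i))⁻¹ : ℝ) : 𝕜)

/-- The associated standard state-space system `(I_r, 𝒜, ℬ, 𝒞, 𝒟)`, obtained by eliminating the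
algebraic variables (`A₂₂` is invertible when the index is at most one) and rescaling
the state with `Σ_E ^ (1/2)`. -/
def standardSystem (R : S.SVD r s) : DescriptorSystem 𝕜 r m where
  E := 1
  A := R.invSqrtSigma * (R.A₁₁ - R.A₁₂ * R.A₂₂⁻¹ * R.A₂₁) * R.invSqrtSigma
  B := R.invSqrtSigma * (R.B₁ - R.A₁₂ * R.A₂₂⁻¹ * R.B₂)
  C := (R.C₁ - R.C₂ * R.A₂₂⁻¹ * R.A₂₁) * R.invSqrtSigma
  D := S.D - R.C₂ * R.A₂₂⁻¹ * R.B₂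

end SVD

end DescriptorSystem

end

/-! The KYP inequality says that `x ↦ xᴴ X x` is a storage function: along every step `x ↦ A x + B
u`, its increase is at most the supply, a quadratic form in input and output. Both supply rates are
instances of `α|u|² + 2β Re(uᴴy) - γ|y|²` with `γ ≥ 0`: impedance is `(0, 1, 0)`, scattering is `(1,
0, 1)`.

Reduction. A kernel vector of `A₂₂` would give a chain `E x = 0`, `A x = E y` with `x ≠ 0`, which
index at most one excludes (`isUnit_A₂₂`). Block elimination then splits the pencil into the
standard one and an invertible constant block (`exists_restrictedEquivalence`), so the standard
system has the same transfer function (`transfer_eq`) and inherits the Hautus condition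
(`standardSystem_hautus`).

Frequency to time. With `w = 1/z`, input and output become power series in the unit disc. Averaging
the pointwise inequality over circles and letting the radius tend to 1 shows, by a Bessel-type
estimate, that no trajectory from the zero state has negative total supply (`sum_supplyRate_nonneg`,
`sum_supplyRate_nonneg_of_transfer`).

Time to storage. The available storage, the supremum of extracted supply over all continuations, is
finite because every state is reachable from 0. It is obtained as a monotone limit of finite-horizon
value functions, which are quadratic forms once the supply is regularised by `ε|u|²`
(`exists_valueFunction`, `exists_storageFunction`). Neither observability nor stability of the state
matrix is needed. Over `ℝ` the construction uses real inputs only, so `X` is real; complex numbers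
enter only through the frequency-domain and Hautus tests. -/

noncomputable section

open Filter Topology

/-! ### Quadratic storage functions by dynamic programming. -/

section Storage

variable {𝕜 : Type*} [RCLike 𝕜] {ι κ : Type*} [Fintype ι] [Fintype κ]

/-- The real part of the sesquilinear form `v ↦ vᴴ M v`. -/
def Matrix.reForm (M : Matrix ι ι 𝕜) (v : ι → 𝕜) : ℝ :=
  RCLike.re (star v ⬝ᵥ M *ᵥ v)

lemma Matrix.IsHermitian.coe_reForm {M : Matrix ι ι 𝕜} (hM : M.IsHermitian) (v : ι → 𝕜) :
    ((M.reForm v : ℝ) : 𝕜) = star v ⬝ᵥ M *ᵥ v :=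
  RCLike.conj_eq_iff_re.1 <| by
    rw [starRingEnd_apply, ← Matrix.star_dotProduct, Matrix.star_mulVec, hM.eq,
      ← Matrix.dotProduct_mulVec]

lemma Matrix.IsHermitian.posSemidef_of_reForm_nonneg {M : Matrix ι ι 𝕜} (hM : M.IsHermitian)
    (h : ∀ v, 0 ≤ M.reForm v) : M.PosSemidef :=
  .of_dotProduct_mulVec_nonneg hM fun v => by
    rw [← hM.coe_reForm]; exact RCLike.ofReal_nonneg.2 (h v)

lemma Matrix.PosSemidef.reForm_nonneg {M : Matrix ι ι 𝕜} (hM : M.PosSemidef) (v : ι → 𝕜) :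
    0 ≤ M.reForm v :=
  (RCLike.nonneg_iff.1 (hM.dotProduct_mulVec_nonneg v)).1

lemma Matrix.reForm_add (M N : Matrix ι ι 𝕜) (v : ι → 𝕜) :
    (M + N).reForm v = M.reForm v + N.reForm v := by
  simp [Matrix.reForm, Matrix.add_mulVec]

lemma Matrix.reForm_sub (M N : Matrix ι ι 𝕜) (v : ι → 𝕜) :
    (M - N).reForm v = M.reForm v - N.reForm v := by
  simp [Matrix.reForm, Matrix.sub_mulVec]

lemma Matrix.reForm_neg (M : Matrix ι ι 𝕜) (v : ι → 𝕜) : (-M).reForm v = -M.reForm v := by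
  simp [Matrix.reForm, Matrix.neg_mulVec]

lemma Matrix.reForm_zero_right (M : Matrix ι ι 𝕜) : M.reForm 0 = 0 := by
  simp [Matrix.reForm]

lemma Matrix.reForm_conjTranspose_mul_mul (X : Matrix ι ι 𝕜) (A : Matrix ι κ 𝕜) (v : κ → 𝕜) :
    (Aᴴ * X * A).reForm v = X.reForm (A *ᵥ v) := by
  simp only [Matrix.reForm, Matrix.star_mulVec, Matrix.dotProduct_mulVec, Matrix.vecMul_vecMul]

/-- The supply accumulated along the trajectory of `x ↦ A x + B u` from `x` under a finite list of
inputs, for the supply rate given by the form of `M` in the pair (state, input). -/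
def cumulativeSupply (A : Matrix ι ι 𝕜) (B : Matrix ι κ 𝕜) (M : Matrix (ι ⊕ κ) (ι ⊕ κ) 𝕜) :
    (ι → 𝕜) → List (κ → 𝕜) → ℝ
  | _, [] => 0
  | x, u :: us => M.reForm (Sum.elim x u) + cumulativeSupply A B M (A *ᵥ x + B *ᵥ u) us

/-- The state reached from `x` under a finite list of inputs. -/
def finalState (A : Matrix ι ι 𝕜) (B : Matrix ι κ 𝕜) (x : ι → 𝕜) (us : List (κ → 𝕜)) : ι → 𝕜 :=
  us.foldl (fun x u => A *ᵥ x + B *ᵥ u) x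

variable {A : Matrix ι ι 𝕜} {B : Matrix ι κ 𝕜} {M N : Matrix (ι ⊕ κ) (ι ⊕ κ) 𝕜}

lemma cumulativeSupply_append (x : ι → 𝕜) (us vs : List (κ → 𝕜)) :
    cumulativeSupply A B M x (us ++ vs) =
      cumulativeSupply A B M x us + cumulativeSupply A B M (finalState A B x us) vs := by
  induction us generalizing x with
  | nil => simp [cumulativeSupply, finalState]
  | cons u us ih => simp [cumulativeSupply, ih, finalState, add_assoc]

lemma cumulativeSupply_mono (h : ∀ v, M.reForm v ≤ N.reForm v) (x : ι → 𝕜)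
    (us : List (κ → 𝕜)) : cumulativeSupply A B M x us ≤ cumulativeSupply A B N x us := by
  induction us generalizing x with
  | nil => simp [cumulativeSupply]
  | cons u us ih => exact add_le_add (h _) (ih _)

/-- Completion of squares in the second variable. -/
lemma Matrix.IsHermitian.exists_completion_of_squares [DecidableEq κ] (hM : M.IsHermitian)
    (hpos : ∀ u, u ≠ 0 → 0 < M.reForm (Sum.elim 0 u)) :
    ∃ X : Matrix ι ι 𝕜, X.IsHermitian ∧ (∀ x, ∃ u, M.reForm (Sum.elim x u) = -X.reForm x) ∧
      ∀ x u, -X.reForm x ≤ M.reForm (Sum.elim x u) := by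
  obtain ⟨P, Q, Q', R, rfl⟩ : ∃ P Q Q' R, M = Matrix.fromBlocks P Q Q' R :=
    ⟨_, _, _, _, (Matrix.fromBlocks_toBlocks M).symm⟩
  obtain ⟨hP, hQ, -, hR⟩ := Matrix.isHermitian_fromBlocks_iff.1 hM
  subst hQ
  have hRpos : R.PosDef := .of_dotProduct_mulVec_pos hR fun u hu => by
    have h := hpos u hu
    rw [← hR.coe_reForm]
    refine RCLike.ofReal_pos.2 (h.trans_eq ?_)
    simp [Matrix.reForm, Matrix.fromBlocks_mulVec, Function.star_sumElim]
  have := hRpos.isUnit.invertible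
  have key (x : ι → 𝕜) (u : κ → 𝕜) : (Matrix.fromBlocks P Q Qᴴ R).reForm (Sum.elim x u) =
      R.reForm ((R⁻¹ * Qᴴ) *ᵥ x + u) - (-(P - Q * R⁻¹ * Qᴴ)).reForm x := by
    rw [Matrix.reForm_neg, sub_neg_eq_add]
    simp only [Matrix.reForm, Matrix.dotProduct_mulVec]
    rw [Matrix.schur_complement_eq₂₂ P Q x u hR, map_add]
  -- The minimum over `u` is the Schur complement of `R`, attained where the completed square
  -- vanishes.
  refine ⟨-(P - Q * R⁻¹ * Qᴴ), ?_, fun x => ⟨-((R⁻¹ * Qᴴ) *ᵥ x), ?_⟩, fun x u => ?_⟩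
  · exact ((Matrix.IsHermitian.fromBlocks₂₂ P Q hR).1 hM).neg
  · rw [key]; simp [Matrix.reForm_zero_right]
  · rw [key]; linarith [hRpos.posSemidef.reForm_nonneg ((R⁻¹ * Qᴴ) *ᵥ x + u)]

/-- The optimal cost over a fixed horizon is a quadratic form. -/
lemma exists_valueFunction [DecidableEq κ] (hM : M.IsHermitian)
    (hpos : ∀ u us, u ≠ 0 → 0 < cumulativeSupply A B M 0 (u :: us)) (T : ℕ) :
    ∃ X : Matrix ι ι 𝕜, X.IsHermitian ∧
      (∀ x, ∃ us : List (κ → 𝕜), us.length = T ∧ X.reForm x = -cumulativeSupply A B M x us) ∧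
      ∀ x (us : List (κ → 𝕜)), us.length = T → -cumulativeSupply A B M x us ≤ X.reForm x := by
  induction T with
  | zero =>
    refine ⟨0, Matrix.isHermitian_zero, fun x => ⟨[], rfl, ?_⟩, fun x us h => ?_⟩
    · simp [Matrix.reForm, cumulativeSupply]
    · simp [List.length_eq_zero_iff.1 h, Matrix.reForm, cumulativeSupply]
  | succ T ih =>
    obtain ⟨X, hX, hatt, hle⟩ := ih
    have key (x : ι → 𝕜) (u : κ → 𝕜) :
        (M - (Matrix.fromCols A B)ᴴ * X * Matrix.fromCols A B).reForm (Sum.elim x u) =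
          M.reForm (Sum.elim x u) - X.reForm (A *ᵥ x + B *ᵥ u) := by
      rw [Matrix.reForm_sub, Matrix.reForm_conjTranspose_mul_mul, Matrix.fromCols_mulVec_sumElim]
    -- Bellman step: minimise current supply minus remaining value over the first input. At `x = 0`
    -- this quantity is the supply of an actual trajectory starting with `u`, so `hpos` makes its
    -- input block positive definite.
    obtain ⟨Y, hY, hYatt, hYle⟩ := Matrix.IsHermitian.exists_completion_of_squares
      (hM.sub (Matrix.isHermitian_conjTranspose_mul_mul (Matrix.fromCols A B) hX))
      fun u hu => by
        obtain ⟨us, -, hus⟩ := hatt (A *ᵥ 0 + B *ᵥ u)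
        rw [key, hus, sub_neg_eq_add]
        exact hpos u us hu
    refine ⟨Y, hY, fun x => ?_, fun x us hus => ?_⟩
    · obtain ⟨u, hu⟩ := hYatt x
      obtain ⟨us, hlen, hus⟩ := hatt (A *ᵥ x + B *ᵥ u)
      refine ⟨u :: us, by simp [hlen], ?_⟩
      rw [key] at hu
      rw [cumulativeSupply]; linarith
    · obtain ⟨u, us, rfl⟩ := List.exists_cons_of_length_eq_add_one hus
      have h1 := hYle x u
      have h2 := hle (A *ᵥ x + B *ᵥ u) us (by simpa using hus)
      rw [key] at h1
      rw [cumulativeSupply]; linarith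

/-- Polarisation: taking `c = 1` and `c = I` recovers the real part and minus the imaginary part of
an entry, so convergence of the form forces convergence of the matrix. -/
lemma Matrix.reForm_single_add [DecidableEq ι] {X : Matrix ι ι 𝕜} (hX : X.IsHermitian)
    (i j : ι) (c : 𝕜) :
    X.reForm (Pi.single i 1 + Pi.single j c) - X.reForm (Pi.single i 1) - X.reForm (Pi.single j c)
      = 2 * RCLike.re (X i j * c) := by
  have h : RCLike.re (star c * X j i) = RCLike.re (X i j * c) := by
    rw [← hX.apply i j, ← RCLike.conj_re (star (X j i) * c)]
    simp [mul_comm]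
  simp only [Matrix.reForm, star_add, Matrix.mulVec_add, dotProduct_add, add_dotProduct, map_add,
    ← Pi.single_star, single_dotProduct, Matrix.mulVec_single, Matrix.col_apply, star_one,
    Pi.smul_apply, MulOpposite.smul_eq_mul_unop, MulOpposite.unop_op, one_mul]
  have h2 : RCLike.re (star c * (X j i * 1)) = RCLike.re (X i j * c) := by rw [mul_one, h]
  rw [h2]; ring

lemma Matrix.tendsto_reForm {X : ℕ → Matrix ι ι 𝕜} {Y : Matrix ι ι 𝕜}
    (h : Tendsto X atTop (𝓝 Y)) (v : ι → 𝕜) :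
    Tendsto (fun k => (X k).reForm v) atTop (𝓝 (Y.reForm v)) := by
  have : Continuous fun Z : Matrix ι ι 𝕜 => Z.reForm v :=
    RCLike.continuous_re.comp
      (continuous_const.dotProduct (continuous_id.matrix_mulVec continuous_const))
  exact (this.tendsto Y).comp h

/-- Hermitian forms which converge pointwise converge to a Hermitian form. -/
lemma Matrix.exists_isHermitian_tendsto_reForm {X : ℕ → Matrix ι ι 𝕜}
    (hX : ∀ k, (X k).IsHermitian)
    (h : ∀ v, ∃ l, Tendsto (fun k => (X k).reForm v) atTop (𝓝 l)) :
    ∃ Y : Matrix ι ι 𝕜, Y.IsHermitian ∧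
      ∀ v, Tendsto (fun k => (X k).reForm v) atTop (𝓝 (Y.reForm v)) := by
  classical
  choose l hl using h
  have hre (i j : ι) (c : 𝕜) : ∃ a, Tendsto (fun k => RCLike.re (X k i j * c)) atTop (𝓝 a) := by
    refine ⟨_, ((((hl (Pi.single i 1 + Pi.single j c)).sub (hl (Pi.single i 1))).sub
      (hl (Pi.single j c))).div_const 2).congr fun k => ?_⟩
    rw [Matrix.reForm_single_add (hX k)]; ring
  have hent (i j : ι) : ∃ a, Tendsto (fun k => X k i j) atTop (𝓝 a) := by
    obtain ⟨a, ha⟩ := hre i j 1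
    obtain ⟨b, hb⟩ := hre i j RCLike.I
    refine ⟨_, (((RCLike.continuous_ofReal (K := 𝕜)).tendsto a).comp ha).add
      ((((RCLike.continuous_ofReal (K := 𝕜)).tendsto _).comp hb.neg).mul_const RCLike.I)
      |>.congr fun k => ?_⟩
    conv_rhs => rw [← RCLike.re_add_im (X k i j)]
    simp
  choose Y hY using hent
  have hlim : Tendsto X atTop (𝓝 (Matrix.of Y)) :=
    tendsto_pi_nhds.2 fun i => tendsto_pi_nhds.2 fun j => hY i j
  refine ⟨Matrix.of Y, ?_, Matrix.tendsto_reForm hlim⟩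
  ext i j
  have h1 := (continuous_star.tendsto (Y j i)).comp (hY j i)
  exact tendsto_nhds_unique (h1.congr fun k => (hX k).apply i j) (hY i j)

/-- **Existence of a storage function**: if all states are reachable from `0`, no trajectory from
`0` has negative cumulative supply, and the supply rate is nonpositive for the zero input, then
there is a positive semidefinite quadratic storage function. -/
theorem exists_storageFunction (hM : M.IsHermitian)
    (hzero : ∀ x, M.reForm (Sum.elim x 0) ≤ 0)
    (hdiss : ∀ us, 0 ≤ cumulativeSupply A B M 0 us)
    (hreach : ∀ x, ∃ us, finalState A B 0 us = x) :
    ∃ X : Matrix ι ι 𝕜, X.PosSemidef ∧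
      ∀ x u, X.reForm (A *ᵥ x + B *ᵥ u) - X.reForm x ≤ M.reForm (Sum.elim x u) := by
  classical
  let Q : Matrix (ι ⊕ κ) (ι ⊕ κ) 𝕜 := Matrix.fromBlocks 0 0 0 1
  have hQ : Q.PosSemidef := by
    have : Q = Matrix.diagonal (Sum.elim 0 1) := by
      rw [← Matrix.fromBlocks_diagonal]; simp [Q]
    rw [this, Matrix.posSemidef_diagonal_iff]
    rintro (i | i) <;> simp
  have hQpos (x : ι → 𝕜) (u : κ → 𝕜) (hu : u ≠ 0) : 0 < Q.reForm (Sum.elim x u) := by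
    have : Q.reForm (Sum.elim x u) = (1 : Matrix κ κ 𝕜).reForm u := by
      simp [Q, Matrix.reForm, Matrix.fromBlocks_mulVec, Function.star_sumElim]
    rw [this]
    exact (RCLike.pos_iff.1 (Matrix.PosDef.one.dotProduct_mulVec_pos hu)).1
  have hQzero (x : ι → 𝕜) : Q.reForm (Sum.elim x 0) = 0 := by
    simp [Q, Matrix.reForm, Matrix.fromBlocks_mulVec, Function.star_sumElim]
  -- The form of `M` may be degenerate in the input, so `ε k |u|²` is added to make the minimisation
  -- strictly convex. Horizon and regularisation are tied together: horizon `k` uses weight `ε k`,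
  -- and one limit removes both.
  let ε : ℕ → ℝ := fun k => 1 / ((k : ℝ) + 1)
  have hε (k : ℕ) : 0 < ε k := by positivity
  have hεanti (k : ℕ) : ε (k + 1) ≤ ε k :=
    one_div_le_one_div_of_le (by positivity) (by push_cast; linarith)
  let P : ℕ → Matrix (ι ⊕ κ) (ι ⊕ κ) 𝕜 := fun k => M + ((ε k : ℝ) : 𝕜) • Q
  have hP (k : ℕ) (v : ι ⊕ κ → 𝕜) : (P k).reForm v = M.reForm v + ε k * Q.reForm v := by
    rw [Matrix.reForm_add]; congr 1
    simp [Matrix.reForm, Matrix.smul_mulVec, RCLike.smul_re]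
  have hMP (k : ℕ) (v : ι ⊕ κ → 𝕜) : M.reForm v ≤ (P k).reForm v := by
    rw [hP]; linarith [mul_nonneg (hε k).le (hQ.reForm_nonneg v)]
  have hPP (k : ℕ) (v : ι ⊕ κ → 𝕜) : (P (k + 1)).reForm v ≤ (P k).reForm v := by
    rw [hP, hP]
    linarith [mul_le_mul_of_nonneg_right (hεanti k) (hQ.reForm_nonneg v)]
  have hPherm (k : ℕ) : (P k).IsHermitian := by
    refine hM.add ?_
    rw [Matrix.IsHermitian, Matrix.conjTranspose_smul, hQ.isHermitian.eq]
    simp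
  have hval (k : ℕ) := exists_valueFunction (A := A) (B := B) (hPherm k) (fun u us hu => by
    have h1 := hdiss (u :: us)
    have h2 := cumulativeSupply_mono (A := A) (B := B) (hMP k) (A *ᵥ 0 + B *ᵥ u) us
    have h3 := mul_pos (hε k) (hQpos 0 u hu)
    rw [cumulativeSupply] at h1 ⊢
    rw [hP]; linarith) k
  choose X hX hatt hle using hval
  -- Extend an optimal input list by a final zero input: by `hzero` it adds no positive supply, its
  -- regularisation cost is zero, and the smaller weight only lowers the other costs.
  have hmono (x : ι → 𝕜) : Monotone fun k => (X k).reForm x := by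
    refine monotone_nat_of_le_succ fun k => ?_
    obtain ⟨us, hlen, hus⟩ := hatt k x
    have h1 := cumulativeSupply_mono (A := A) (B := B) (hPP k) x us
    have h2 := hle (k + 1) x (us ++ [0]) (by simp [hlen])
    have h3 := hzero (finalState A B x us)
    rw [cumulativeSupply_append] at h2
    simp only [cumulativeSupply, hP, hQzero] at h2
    linarith
  -- Drive 0 to `x` by `vs`, then continue optimally: since the whole supply is nonnegative, at most
  -- the supply spent along `vs` can be extracted from `x`.
  have hbdd (x : ι → 𝕜) : BddAbove (Set.range fun k => (X k).reForm x) := by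
    obtain ⟨vs, hvs⟩ := hreach x
    refine ⟨cumulativeSupply A B M 0 vs, ?_⟩
    rintro _ ⟨k, rfl⟩
    obtain ⟨us, hlen, hus⟩ := hatt k x
    have h1 := hdiss (vs ++ us)
    have h2 := cumulativeSupply_mono (A := A) (B := B) (hMP k) x us
    rw [cumulativeSupply_append, hvs] at h1
    simp only [hus]; linarith
  obtain ⟨Y, hY, hlim⟩ := Matrix.exists_isHermitian_tendsto_reForm hX
    fun x => ⟨_, tendsto_atTop_ciSup (hmono x) (hbdd x)⟩
  refine ⟨Y, hY.posSemidef_of_reForm_nonneg fun x => ?_, fun x u => ?_⟩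
  -- The horizon-zero value is 0 and the values increase, so the limit is nonnegative.
  · obtain ⟨us, hlen, hus⟩ := hatt 0 x
    rw [List.length_eq_zero_iff] at hlen
    subst hlen
    have : 0 = (X 0).reForm x := by simp [hus, cumulativeSupply]
    exact this.trans_le ((hmono x).ge_of_tendsto (hlim x) 0)
  -- Prepending `u` to an optimal list for the successor state gives a competitor on horizon `k +
  -- 1`; the limit of this inequality is the dissipation inequality.
  · have hstep (k : ℕ) : (X k).reForm (A *ᵥ x + B *ᵥ u) - (X (k + 1)).reForm x ≤
        M.reForm (Sum.elim x u) + ε k * Q.reForm (Sum.elim x u) := by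
      obtain ⟨us, hlen, hus⟩ := hatt k (A *ᵥ x + B *ᵥ u)
      have h1 := cumulativeSupply_mono (A := A) (B := B) (hPP k) x (u :: us)
      have h2 := hle (k + 1) x (u :: us) (by simp [hlen])
      have h3 : cumulativeSupply A B (P k) x (u :: us) = (P k).reForm (Sum.elim x u) +
        cumulativeSupply A B (P k) (A *ᵥ x + B *ᵥ u) us := rfl
      rw [← hP]; linarith
    have hε0 : Tendsto ε atTop (𝓝 0) := tendsto_one_div_add_atTop_nhds_zero_nat
    have hr := (hε0.mul_const (Q.reForm (Sum.elim x u))).const_add (M.reForm (Sum.elim x u))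
    rw [zero_mul, add_zero] at hr
    exact le_of_tendsto_of_tendsto'
      ((hlim _).sub ((tendsto_add_atTop_iff_nat 1).2 (hlim x))) hr hstep

end Storage

/-! ### Circle averages and passage from frequency to time. -/

section CircleAverage

open Metric Real ComplexConjugate Asymptotics

lemma DifferentiableOn.circleAverage_eq {f : ℂ → ℂ} (hf : DifferentiableOn ℂ f (ball 0 1))
    {ρ : ℝ} (h0 : 0 < ρ) (h1 : ρ < 1) : circleAverage f 0 ρ = f 0 :=
  (hf.diffContOnCl_ball (by
    rw [abs_of_pos h0]; exact closedBall_subset_ball h1)).circleAverage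

lemma circleIntegrable_of_continuousOn_ball {f : ℂ → ℂ} (hf : ContinuousOn f (ball 0 1))
    {ρ : ℝ} (h0 : 0 < ρ) (h1 : ρ < 1) : CircleIntegrable f 0 ρ :=
  (hf.mono ((sphere_subset_closedBall).trans (closedBall_subset_ball h1))).circleIntegrable h0.le

lemma circleAverage_conj_pow_succ (j : ℕ) {ρ : ℝ} (h0 : 0 < ρ) (h1 : ρ < 1) :
    circleAverage (fun w => conj w ^ (j + 1)) 0 ρ = 0 := by
  have hd : DifferentiableOn ℂ (fun w : ℂ => w ^ (j + 1)) (ball 0 1) := by fun_prop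
  have h := (Complex.conjCLE : ℂ →L[ℝ] ℂ).circleAverage_comp_comm
    (circleIntegrable_of_continuousOn_ball hd.continuousOn h0 h1)
  rw [hd.circleAverage_eq h0 h1] at h
  simpa [Function.comp_def] using h

/-- Circle averages of an analytic function against powers of `conj w` are Taylor coefficients. -/
lemma circleAverage_conj_pow_mul {N : ℕ} {f : ℂ → ℂ} {c : ℕ → ℂ}
    (hf : DifferentiableOn ℂ f (ball 0 1))
    (hO : (fun w => f w - ∑ k ∈ Finset.range N, c k * w ^ k) =O[𝓝[≠] 0] fun w => w ^ N)
    {j : ℕ} (hj : j < N) {ρ : ℝ} (h0 : 0 < ρ) (h1 : ρ < 1) :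
    circleAverage (fun w => conj w ^ j * f w) 0 ρ = (ρ : ℂ) ^ (2 * j) * c j := by
  induction N generalizing f c j with
  | zero => omega
  | succ N ih =>
    have hball : ball (0 : ℂ) 1 ∈ 𝓝 0 := ball_mem_nhds _ one_pos
    -- The expansion is only known on a punctured neighbourhood; continuity of `f` supplies the
    -- value at 0.
    have hc0 : f 0 = c 0 := by
      have h2 : Tendsto (fun w : ℂ => w ^ (N + 1)) (𝓝[≠] 0) (𝓝 0) := by
        have : ContinuousAt (fun w : ℂ => w ^ (N + 1)) 0 := by fun_prop
        simpa [ContinuousAt] using this.tendsto.mono_left nhdsWithin_le_nhds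
      have h3 := hO.trans_tendsto h2
      have h4 : ContinuousAt (fun w => f w - ∑ k ∈ Finset.range (N + 1), c k * w ^ k) 0 :=
        (hf.continuousOn.continuousAt hball).sub (by fun_prop)
      have h5 := tendsto_nhds_unique h3 (h4.tendsto.mono_left nhdsWithin_le_nhds)
      rw [Finset.sum_range_succ'] at h5
      simp only [ne_eq, Nat.add_eq_zero_iff, one_ne_zero, and_false, not_false_eq_true, zero_pow,
        mul_zero, Finset.sum_const_zero, pow_zero, mul_one, zero_add] at h5
      exact (sub_eq_zero.1 h5.symm)
    cases j with
    | zero => simpa [hc0] using hf.circleAverage_eq h0 h1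
    | succ j =>
      -- Peel off the constant term: `f w = c 0 + w g w` with `g` having shifted coefficients. On
      -- the circle `conj w * w = ρ²`, which lowers the power of `conj w` by one.
      have hg : DifferentiableOn ℂ (dslope f 0) (ball 0 1) :=
        (Complex.differentiableOn_dslope hball).2 hf
      have hfg (w : ℂ) : f w = c 0 + w * dslope f 0 w := by
        have := sub_smul_dslope f 0 w
        simp only [sub_zero, smul_eq_mul] at this
        rw [this, ← hc0]; ring
      have hgO : (fun w => dslope f 0 w - ∑ k ∈ Finset.range N, c (k + 1) * w ^ k)
          =O[𝓝[≠] 0] fun w => w ^ N := by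
        have h2 : (fun w : ℂ => w⁻¹) =O[𝓝[≠] 0] fun w : ℂ => w⁻¹ := isBigO_refl _ _
        refine (h2.mul hO).congr' ?_ ?_
        · filter_upwards [self_mem_nhdsWithin] with w hw
          have hw : w ≠ 0 := hw
          rw [hfg w, Finset.sum_range_succ', inv_mul_eq_iff_eq_mul₀ hw, mul_sub, Finset.mul_sum,
            Finset.sum_congr rfl fun k _ => show c (k + 1) * w ^ (k + 1) = w * (c (k + 1) * w ^ k)
              by ring]
          ring
        · filter_upwards [self_mem_nhdsWithin] with w hw
          have hw : w ≠ 0 := hw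
          rw [pow_succ', inv_mul_cancel_left₀ hw]
      have hcont : ContinuousOn (fun w : ℂ => conj w ^ j * dslope f 0 w) (ball 0 1) :=
        (by fun_prop : Continuous fun w : ℂ => conj w ^ j).continuousOn.mul hg.continuousOn
      have hcont2 : ContinuousOn (fun w : ℂ => conj w ^ (j + 1)) (ball 0 1) := by fun_prop
      calc circleAverage (fun w => conj w ^ (j + 1) * f w) 0 ρ
          = circleAverage (fun w => c 0 • conj w ^ (j + 1) +
              ((ρ : ℂ) ^ 2) • (conj w ^ j * dslope f 0 w)) 0 ρ := by
            refine circleAverage_congr_sphere fun w hw => ?_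
            have hw2 : conj w * w = (ρ : ℂ) ^ 2 := by
              rw [abs_of_pos h0, mem_sphere_zero_iff_norm] at hw
              rw [Complex.conj_mul', hw]
            simp only [hfg w, smul_eq_mul, ← hw2]
            ring
        _ = (ρ : ℂ) ^ (2 * (j + 1)) * c (j + 1) := by
            rw [circleAverage_fun_add, circleAverage_fun_smul, circleAverage_fun_smul,
              circleAverage_conj_pow_succ j h0 h1, ih hg hgO (by omega)]
            · simp only [smul_eq_mul]; ring
            · exact circleIntegrable_of_continuousOn_ball (hcont2.const_smul (c 0)) h0 h1
            · exact circleIntegrable_of_continuousOn_ball (hcont.const_smul ((ρ : ℂ) ^ 2)) h0 h1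

lemma circleAverage_conj_sum_mul {N : ℕ} {f : ℂ → ℂ} {c : ℕ → ℂ} (q : ℕ → ℂ)
    (hf : DifferentiableOn ℂ f (ball 0 1))
    (hO : (fun w => f w - ∑ k ∈ Finset.range N, c k * w ^ k) =O[𝓝[≠] 0] fun w => w ^ N)
    {ρ : ℝ} (h0 : 0 < ρ) (h1 : ρ < 1) :
    circleAverage (fun w => conj (∑ k ∈ Finset.range N, q k * w ^ k) * f w) 0 ρ =
      ∑ k ∈ Finset.range N, (ρ : ℂ) ^ (2 * k) * (conj (q k) * c k) := by
  have hcont (k : ℕ) : ContinuousOn (fun w : ℂ => conj w ^ k * f w) (ball 0 1) :=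
    (by fun_prop : Continuous fun w : ℂ => conj w ^ k).continuousOn.mul hf.continuousOn
  have : (fun w => conj (∑ k ∈ Finset.range N, q k * w ^ k) * f w) =
      fun w => ∑ k ∈ Finset.range N, conj (q k) • (conj w ^ k * f w) := by
    funext w
    simp only [map_sum, map_mul, map_pow, Finset.sum_mul, smul_eq_mul, mul_assoc]
  have hint (k : ℕ) (_ : k ∈ Finset.range N) :
      CircleIntegrable (fun w => conj (q k) • (conj w ^ k * f w)) 0 ρ :=
    circleIntegrable_of_continuousOn_ball ((hcont k).const_smul (conj (q k))) h0 h1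
  rw [this, circleAverage_fun_sum hint]
  refine Finset.sum_congr rfl fun k hk => ?_
  rw [circleAverage_fun_smul, circleAverage_conj_pow_mul hf hO (Finset.mem_range.1 hk) h0 h1]
  simp only [smul_eq_mul]; ring

/-- The scalar supply rate `α |a|² + 2 β Re (ā b) - γ |b|²`. -/
def supplyRate (α β γ : ℝ) (a b : ℂ) : ℝ :=
  (α * (conj a * a) + 2 * β * (conj a * b) - γ * (conj b * b) : ℂ).re

/-- From `|b - p|² ≥ 0` one gets `|b|² ≥ 2 Re(p̄ b) - |p|²`. With `p` the truncated Taylor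
polynomial of the output `b`, the right side averages to a finite sum, so the tail of the output
never has to be summed. -/
lemma supplyRate_le (α β : ℝ) {γ : ℝ} (hγ : 0 ≤ γ) (a b p : ℂ) :
    supplyRate α β γ a b ≤
      (α * (conj a * a) + 2 * β * (conj a * b) - γ * (2 * (conj p * b) - conj p * p) : ℂ).re := by
  have h : (conj b * b - (2 * (conj p * b) - conj p * p)).re = Complex.normSq (b - p) := by
    simp [Complex.normSq_apply]; ring
  have h2 : (α * (conj a * a) + 2 * β * (conj a * b) - γ * (2 * (conj p * b) - conj p * p) : ℂ).re
      = supplyRate α β γ a b + γ * (conj b * b - (2 * (conj p * b) - conj p * p)).re := by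
    rw [supplyRate, ← Complex.re_ofReal_mul, ← Complex.add_re]
    congr 1; ring
  rw [h2, h]
  exact le_add_of_nonneg_right (mul_nonneg hγ (Complex.normSq_nonneg _))

/-- **From the frequency domain to the time domain**: if the supply rate is nonnegative at all
frequencies along an input polynomial and the analytic output, the supply accumulated along the
coefficient sequences is nonnegative. -/
theorem sum_supplyRate_nonneg {κ : Type*} [Fintype κ] (α β : ℝ) {γ : ℝ} (hγ : 0 ≤ γ) (N : ℕ)
    (u y : κ → ℕ → ℂ) (Y : κ → ℂ → ℂ) (hY : ∀ i, DifferentiableOn ℂ (Y i) (ball 0 1))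
    (hO : ∀ i, (fun w => Y i w - ∑ k ∈ Finset.range N, y i k * w ^ k)
      =O[𝓝[≠] 0] fun w => w ^ N)
    (hpos : ∀ w, w ≠ 0 → ‖w‖ < 1 →
      0 ≤ ∑ i, supplyRate α β γ (∑ k ∈ Finset.range N, u i k * w ^ k) (Y i w)) :
    0 ≤ ∑ k ∈ Finset.range N, ∑ i, supplyRate α β γ (u i k) (y i k) := by
  have main (ρ : ℝ) (h0 : 0 < ρ) (h1 : ρ < 1) :
      0 ≤ ∑ k ∈ Finset.range N, ρ ^ (2 * k) * ∑ i, supplyRate α β γ (u i k) (y i k) := by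
    let U : κ → ℂ → ℂ := fun i w => ∑ k ∈ Finset.range N, u i k * w ^ k
    let p : κ → ℂ → ℂ := fun i w => ∑ k ∈ Finset.range N, y i k * w ^ k
    have hU (i) : DifferentiableOn ℂ (U i) (ball 0 1) := by fun_prop
    have hp (i) : DifferentiableOn ℂ (p i) (ball 0 1) := by fun_prop
    -- The majorant from `supplyRate_le`: each term pairs the conjugate of a polynomial with an
    -- analytic function, so its circle average involves only coefficients below `N`.
    let Φ : κ → ℂ → ℂ := fun i w => (α : ℂ) • (conj (U i w) * U i w) +
      (2 * β : ℂ) • (conj (U i w) * Y i w) + (-2 * γ : ℂ) • (conj (p i w) * Y i w) +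
      (γ : ℂ) • (conj (p i w) * p i w)
    have hconj {f : ℂ → ℂ} (hf : DifferentiableOn ℂ f (ball 0 1)) :
        ContinuousOn (fun w => conj (f w)) (ball 0 1) :=
      Complex.continuous_conj.comp_continuousOn hf.continuousOn
    have c1 (i) : ContinuousOn (fun w => (α : ℂ) • (conj (U i w) * U i w)) (ball 0 1) :=
      ((hconj (hU i)).mul (hU i).continuousOn).const_smul (α : ℂ)
    have c2 (i) : ContinuousOn (fun w => (2 * β : ℂ) • (conj (U i w) * Y i w)) (ball 0 1) :=
      ((hconj (hU i)).mul (hY i).continuousOn).const_smul (2 * β : ℂ)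
    have c3 (i) : ContinuousOn (fun w => (-2 * γ : ℂ) • (conj (p i w) * Y i w)) (ball 0 1) :=
      ((hconj (hp i)).mul (hY i).continuousOn).const_smul (-2 * γ : ℂ)
    have c4 (i) : ContinuousOn (fun w => (γ : ℂ) • (conj (p i w) * p i w)) (ball 0 1) :=
      ((hconj (hp i)).mul (hp i).continuousOn).const_smul (γ : ℂ)
    have hΦc (i) : ContinuousOn (Φ i) (ball 0 1) := (((c1 i).add (c2 i)).add (c3 i)).add (c4 i)
    have hint {f : ℂ → ℂ} (hf : ContinuousOn f (ball 0 1)) : CircleIntegrable f 0 ρ :=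
      circleIntegrable_of_continuousOn_ball hf h0 h1
    have hO' (c : ℕ → ℂ) : (fun w => (∑ k ∈ Finset.range N, c k * w ^ k) -
        ∑ k ∈ Finset.range N, c k * w ^ k) =O[𝓝[≠] 0] fun w : ℂ => w ^ N := by
      simpa using isBigO_zero _ _
    have hΦ (i) : circleAverage (Φ i) 0 ρ = ∑ k ∈ Finset.range N, (ρ : ℂ) ^ (2 * k) *
        (α * (conj (u i k) * u i k) + 2 * β * (conj (u i k) * y i k) -
          γ * (conj (y i k) * y i k)) := by
      simp only [Φ]
      rw [circleAverage_fun_add (hint (((c1 i).fun_add (c2 i)).fun_add (c3 i))) (hint (c4 i)),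
        circleAverage_fun_add (hint ((c1 i).fun_add (c2 i))) (hint (c3 i)),
        circleAverage_fun_add (hint (c1 i)) (hint (c2 i)),
        circleAverage_fun_smul, circleAverage_fun_smul, circleAverage_fun_smul,
        circleAverage_fun_smul, circleAverage_conj_sum_mul (u i) (hU i) (hO' _) h0 h1,
        circleAverage_conj_sum_mul (u i) (hY i) (hO i) h0 h1,
        circleAverage_conj_sum_mul (y i) (hY i) (hO i) h0 h1,
        circleAverage_conj_sum_mul (y i) (hp i) (hO' _) h0 h1]
      simp only [smul_eq_mul, Finset.mul_sum, ← Finset.sum_add_distrib]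
      refine Finset.sum_congr rfl fun k _ => ?_
      ring
    have hsum : circleAverage (fun w => ∑ i, Φ i w) 0 ρ = ∑ i, circleAverage (Φ i) 0 ρ :=
      circleAverage_fun_sum fun i _ => hint (hΦc i)
    have hre : circleAverage (Complex.reCLM ∘ fun w => ∑ i, Φ i w) 0 ρ =
        Complex.reCLM (circleAverage (fun w => ∑ i, Φ i w) 0 ρ) :=
      Complex.reCLM.circleAverage_comp_comm
        (hint (continuousOn_finsetSum _ fun i _ => hΦc i))
    have hnn : 0 ≤ circleAverage (Complex.reCLM ∘ fun w => ∑ i, Φ i w) 0 ρ := by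
      refine circleAverage_nonneg_of_nonneg fun w hw => ?_
      rw [abs_of_pos h0, mem_sphere_zero_iff_norm] at hw
      refine (hpos w (norm_pos_iff.1 (hw ▸ h0)) (hw ▸ h1)).trans ?_
      simp only [Function.comp_apply, Complex.reCLM_apply, Complex.re_sum]
      refine Finset.sum_le_sum fun i _ => (supplyRate_le α β hγ _ _ (p i w)).trans_eq ?_
      congr 1
      simp only [Φ, smul_eq_mul, U]
      ring
    rw [hre, hsum, Complex.reCLM_apply, Complex.re_sum] at hnn
    refine hnn.trans_eq ?_
    simp only [hΦ, Complex.re_sum, Finset.mul_sum]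
    rw [Finset.sum_comm]
    refine Finset.sum_congr rfl fun k _ => Finset.sum_congr rfl fun i _ => ?_
    rw [supplyRate, ← Complex.re_ofReal_mul]
    push_cast
    rfl
  have hlim : Tendsto (fun ρ : ℝ => ∑ k ∈ Finset.range N,
      ρ ^ (2 * k) * ∑ i, supplyRate α β γ (u i k) (y i k)) (𝓝[<] 1)
      (𝓝 (∑ k ∈ Finset.range N, ∑ i, supplyRate α β γ (u i k) (y i k))) := by
    have : Continuous (fun ρ : ℝ => ∑ k ∈ Finset.range N,
      ρ ^ (2 * k) * ∑ i, supplyRate α β γ (u i k) (y i k)) := by fun_prop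
    simpa using (this.tendsto 1).mono_left nhdsWithin_le_nhds
  refine ge_of_tendsto hlim ?_
  filter_upwards [Ioo_mem_nhdsLT one_pos] with ρ hρ using main ρ hρ.1 hρ.2

end CircleAverage

/-! ### Unitary factors in block coordinates. -/

section Reindex

variable {𝕜 : Type*} [RCLike 𝕜] {n : ℕ} {ι : Type*}

lemma Matrix.exists_inverse_submatrix_left [Fintype ι] {M : Matrix (Fin n) (Fin n) 𝕜}
    (hM : IsUnit M) (e : ι ≃ Fin n) : ∃ M' : Matrix (Fin n) ι 𝕜, M' * M.submatrix e id = 1 := by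
  refine ⟨M⁻¹.submatrix id e, ?_⟩
  rw [Matrix.submatrix_mul_equiv, Matrix.nonsing_inv_mul _ ((Matrix.isUnit_iff_isUnit_det _).1 hM),
    Matrix.submatrix_id_id]

lemma Matrix.exists_inverse_submatrix_right [Fintype ι] {M : Matrix (Fin n) (Fin n) 𝕜}
    (hM : IsUnit M) (e : ι ≃ Fin n) : ∃ M' : Matrix ι (Fin n) 𝕜, M.submatrix id e * M' = 1 := by
  refine ⟨M⁻¹.submatrix e id, ?_⟩
  rw [Matrix.submatrix_mul_equiv, Matrix.mul_nonsing_inv _ ((Matrix.isUnit_iff_isUnit_det _).1 hM),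
    Matrix.submatrix_id_id]

lemma Matrix.mul_mul_submatrix (M N P : Matrix (Fin n) (Fin n) 𝕜) (e : ι ≃ Fin n) :
    M.submatrix e id * N * P.submatrix id e = (M * N * P).submatrix e e := by
  rw [Matrix.submatrix_mul _ _ e id e Function.bijective_id,
    Matrix.submatrix_mul _ _ e id id Function.bijective_id, Matrix.submatrix_id_id]

end Reindex

/-! ### Elimination of the algebraic variables. -/

namespace DescriptorSystem

variable {𝕜 : Type*} [RCLike 𝕜] {n m : ℕ} {S : DescriptorSystem 𝕜 n m} {r s : ℕ}

namespace SVD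

lemma isUnit_U (R : S.SVD r s) : IsUnit R.U := by
  have := (Unitary.toUnits ⟨R.U, R.U_mem⟩).isUnit
  simpa using this

lemma isUnit_V (R : S.SVD r s) : IsUnit R.V := by
  have := (Unitary.toUnits ⟨R.V, R.V_mem⟩).isUnit
  simpa using this

/-- If `(E, A)` has index at most one, the block `A₂₂` is invertible. -/
theorem isUnit_A₂₂ (R : S.SVD r s) (hidx : HasIndexAtMost S.E S.A 1) : IsUnit R.A₂₂ := by
  rw [Matrix.isUnit_iff_isUnit_det, isUnit_iff_ne_zero]
  intro hdet
  obtain ⟨v, hv, hA⟩ := Matrix.exists_mulVec_eq_zero_iff.2 hdet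
  refine hv ?_
  obtain ⟨p, q, h, P, T, Af, N, hP, hT, hN, hE', hA'⟩ := hidx
  rw [pow_one] at hN
  subst hN
  obtain ⟨U', hU'⟩ := Matrix.exists_inverse_submatrix_left R.isUnit_U (blockEquiv R.dim)
  obtain ⟨V', hV'⟩ := Matrix.exists_inverse_submatrix_right R.isUnit_V (blockEquiv R.dim)
  obtain ⟨T', hT'⟩ := Matrix.exists_inverse_submatrix_right hT (blockEquiv h)
  have hV'2 : V' * R.V.submatrix id (blockEquiv R.dim) = 1 :=
    (Matrix.mul_eq_one_comm_of_equiv (blockEquiv R.dim).symm).1 hV'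
  have hUE := R.eq
  have hUA : R.UAV = Matrix.fromBlocks R.A₁₁ R.A₁₂ R.A₂₁ R.A₂₂ :=
    (Matrix.fromBlocks_toBlocks _).symm
  rw [UAV] at hUA
  rw [← Matrix.mul_mul_submatrix] at hUE hUA hE' hA'
  set Ub := R.U.submatrix (blockEquiv R.dim) id
  set Vb := R.V.submatrix id (blockEquiv R.dim)
  set Pb := P.submatrix (blockEquiv h) id
  set Tb := T.submatrix id (blockEquiv h)
  have hinj {a b : Fin n → 𝕜} (hab : Ub *ᵥ a = Ub *ᵥ b) : a = b := by
    have := congrArg (U' *ᵥ ·) hab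
    simpa [Matrix.mulVec_mulVec, hU'] using this
  -- Chosen so that `Σ_E σ' = A₁₂ v`; since `A₂₂ v = 0`, this yields `A x = E y`.
  let σ' : Fin r → 𝕜 := fun i => ((R.σ i : 𝕜))⁻¹ * (R.A₁₂ *ᵥ v) i
  let x := Vb *ᵥ Sum.elim 0 v
  let y := Vb *ᵥ Sum.elim σ' 0
  have hEx : S.E *ᵥ x = 0 := hinj <| by
    rw [Matrix.mulVec_mulVec, Matrix.mulVec_mulVec, hUE, Matrix.fromBlocks_mulVec]
    simp
  have hAx : S.A *ᵥ x = S.E *ᵥ y := hinj <| by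
    rw [Matrix.mulVec_mulVec, Matrix.mulVec_mulVec, Matrix.mulVec_mulVec, Matrix.mulVec_mulVec,
      hUE, hUA, Matrix.fromBlocks_mulVec, Matrix.fromBlocks_mulVec]
    ext (i | i)
    · have : (R.σ i : 𝕜) ≠ 0 := RCLike.ofReal_ne_zero.2 (R.σ_pos i).ne'
      simp [Matrix.mulVec_diagonal, σ', mul_inv_cancel_left₀ this]
    · simp [hA]
  have hTx : Tb *ᵥ (T' *ᵥ x) = x := by rw [Matrix.mulVec_mulVec, hT', Matrix.one_mulVec]
  have hTy : Tb *ᵥ (T' *ᵥ y) = y := by rw [Matrix.mulVec_mulVec, hT', Matrix.one_mulVec]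
  have h1 : (Pb * S.E * Tb) *ᵥ (T' *ᵥ x) = 0 := by
    rw [← Matrix.mulVec_mulVec, hTx, ← Matrix.mulVec_mulVec, hEx, Matrix.mulVec_zero]
  have h2 : (Pb * S.A * Tb) *ᵥ (T' *ᵥ x) = (Pb * S.E * Tb) *ᵥ (T' *ᵥ y) := by
    rw [← Matrix.mulVec_mulVec, hTx, ← Matrix.mulVec_mulVec, hAx,
      ← Matrix.mulVec_mulVec (T' *ᵥ y), hTy, ← Matrix.mulVec_mulVec]
  rw [hE', Matrix.fromBlocks_mulVec] at h1
  rw [hE', hA', Matrix.fromBlocks_mulVec, Matrix.fromBlocks_mulVec] at h2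
  -- In Weierstrass coordinates with `N = 0`, `E x = 0` kills the first component of `x`, and the
  -- lower row of `A x = E y` kills the second.
  have h3 : T' *ᵥ x = 0 := by
    ext (i | i)
    · simpa using congrFun h1 (Sum.inl i)
    · simpa using congrFun h2 (Sum.inr i)
  have h4 : V' *ᵥ x = 0 := by rw [← hTx, h3]; simp
  rw [Matrix.mulVec_mulVec, hV'2, Matrix.one_mulVec] at h4
  ext i
  exact congrFun h4 (Sum.inr i)

lemma isUnit_invSqrtSigma (R : S.SVD r s) : IsUnit R.invSqrtSigma := by
  rw [invSqrtSigma, Matrix.isUnit_diagonal, Pi.isUnit_iff]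
  intro i
  rw [isUnit_iff_ne_zero]
  exact RCLike.ofReal_ne_zero.2 (inv_ne_zero (Real.sqrt_pos.2 (R.σ_pos i)).ne')

lemma invSqrtSigma_mul_mul (R : S.SVD r s) :
    R.invSqrtSigma * Matrix.diagonal (fun i => (R.σ i : 𝕜)) * R.invSqrtSigma = 1 := by
  rw [invSqrtSigma, Matrix.diagonal_mul_diagonal, Matrix.diagonal_mul_diagonal,
    ← Matrix.diagonal_one]
  congr 1
  funext i
  have h := (Real.sqrt_pos.2 (R.σ_pos i)).ne'
  rw [← RCLike.ofReal_mul, ← RCLike.ofReal_mul, ← RCLike.ofReal_one]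
  congr 1
  field_simp
  exact (Real.sq_sqrt (R.σ_pos i).le).symm

/-- The descriptor system is equivalent to its standard system, extended by a static part. -/
theorem exists_restrictedEquivalence (R : S.SVD r s) (hA : IsUnit R.A₂₂) :
    ∃ (L : Matrix (Fin r ⊕ Fin s) (Fin n) 𝕜) (L' : Matrix (Fin n) (Fin r ⊕ Fin s) 𝕜)
      (K : Matrix (Fin n) (Fin r ⊕ Fin s) 𝕜) (K' : Matrix (Fin r ⊕ Fin s) (Fin n) 𝕜),
      L' * L = 1 ∧ K * K' = 1 ∧
      L * S.E * K = Matrix.fromBlocks 1 0 0 0 ∧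
      L * S.A * K = Matrix.fromBlocks R.standardSystem.A 0 0 R.A₂₂ ∧
      L * S.B = Matrix.fromRows R.standardSystem.B R.B₂ ∧
      S.C * K = Matrix.fromCols R.standardSystem.C R.C₂ := by
  obtain ⟨U', hU'⟩ := Matrix.exists_inverse_submatrix_left R.isUnit_U (blockEquiv R.dim)
  obtain ⟨V', hV'⟩ := Matrix.exists_inverse_submatrix_right R.isUnit_V (blockEquiv R.dim)
  have hUE := R.eq
  have hUA : R.UAV = Matrix.fromBlocks R.A₁₁ R.A₁₂ R.A₂₁ R.A₂₂ :=
    (Matrix.fromBlocks_toBlocks _).symm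
  have hUB : (R.U * S.B).submatrix (blockEquiv R.dim) id = Matrix.fromRows R.B₁ R.B₂ :=
    (Matrix.fromRows_toRows _).symm
  have hCV : (S.C * R.V).submatrix id (blockEquiv R.dim) = Matrix.fromCols R.C₁ R.C₂ :=
    (Matrix.fromCols_toCols _).symm
  rw [UAV] at hUA
  rw [← Matrix.mul_mul_submatrix] at hUE hUA
  rw [Matrix.submatrix_mul _ _ _ id _ Function.bijective_id, Matrix.submatrix_id_id] at hUB hCV
  set Ub := R.U.submatrix (blockEquiv R.dim) id
  set Vb := R.V.submatrix id (blockEquiv R.dim)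
  set W := R.invSqrtSigma with hW
  have hWu := (Matrix.isUnit_iff_isUnit_det _).1 R.isUnit_invSqrtSigma
  have hAu := (Matrix.isUnit_iff_isUnit_det _).1 hA
  -- Block Gaussian elimination with pivot `A₂₂`, combined with scaling by `Σ_E^(-1/2)`. The
  -- off-diagonal factors leave `diag(Σ_E, 0)` block diagonal.
  let L₀ : Matrix (Fin r ⊕ Fin s) (Fin r ⊕ Fin s) 𝕜 :=
    Matrix.fromBlocks W (-(W * R.A₁₂ * R.A₂₂⁻¹)) 0 1
  let K₀ : Matrix (Fin r ⊕ Fin s) (Fin r ⊕ Fin s) 𝕜 :=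
    Matrix.fromBlocks W 0 (-(R.A₂₂⁻¹ * R.A₂₁ * W)) 1
  have hL₀ : IsUnit L₀.det := by
    rw [Matrix.det_fromBlocks_zero₂₁, Matrix.det_one, mul_one]; exact hWu
  have hK₀ : IsUnit K₀.det := by
    rw [Matrix.det_fromBlocks_zero₁₂, Matrix.det_one, mul_one]; exact hWu
  have hL (X : Matrix (Fin n) (Fin n) 𝕜) : L₀ * Ub * X * (Vb * K₀) = L₀ * (Ub * X * Vb) * K₀ := by
    simp only [Matrix.mul_assoc]
  refine ⟨L₀ * Ub, U' * L₀⁻¹, Vb * K₀, K₀⁻¹ * V', ?_, ?_, ?_, ?_, ?_, ?_⟩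
  · rw [Matrix.mul_assoc, Matrix.nonsing_inv_mul_cancel_left _ _ hL₀, hU']
  · rw [Matrix.mul_assoc, Matrix.mul_nonsing_inv_cancel_left _ _ hK₀, hV']
  · rw [hL, hUE, Matrix.fromBlocks_multiply, Matrix.fromBlocks_multiply]
    simp [hW, R.invSqrtSigma_mul_mul]
  · rw [hL, hUA, Matrix.fromBlocks_multiply, Matrix.fromBlocks_multiply]
    have e1 : W * R.A₁₂ + -(W * R.A₁₂ * R.A₂₂⁻¹) * R.A₂₂ = 0 := by
      rw [Matrix.neg_mul, Matrix.nonsing_inv_mul_cancel_right _ _ hAu, add_neg_cancel]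
    have e2 : R.A₂₁ * W + R.A₂₂ * -(R.A₂₂⁻¹ * R.A₂₁ * W) = 0 := by
      rw [Matrix.mul_neg, Matrix.mul_assoc R.A₂₂⁻¹, Matrix.mul_nonsing_inv_cancel_left _ _ hAu,
        add_neg_cancel]
    simp only [e1, Matrix.zero_mul, Matrix.mul_zero, Matrix.mul_one, Matrix.one_mul, zero_add,
      add_zero, e2, standardSystem]
    congr 1
    rw [← hW]
    simp only [Matrix.neg_mul, Matrix.mul_assoc, Matrix.add_mul, Matrix.mul_add, Matrix.mul_neg,
      sub_eq_add_neg]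
  · rw [Matrix.mul_assoc, hUB, Matrix.fromBlocks_mul_fromRows]
    simp only [standardSystem, ← hW, Matrix.zero_mul, Matrix.one_mul, zero_add, Matrix.mul_add,
      Matrix.mul_neg, Matrix.neg_mul, Matrix.mul_assoc, sub_eq_add_neg]
  · rw [← Matrix.mul_assoc, hCV, Matrix.fromCols_mul_fromBlocks]
    simp only [standardSystem, ← hW, Matrix.mul_zero, Matrix.mul_one, zero_add, Matrix.add_mul,
      Matrix.neg_mul, Matrix.mul_neg, Matrix.mul_assoc, sub_eq_add_neg]

end SVD

end DescriptorSystem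

/-! ### Reachability and the Popov-Belevitch-Hautus test. -/

section Reachability

variable {𝕜 : Type*} [RCLike 𝕜] {ι κ : Type*} [Fintype ι] [Fintype κ] [DecidableEq ι]

/-- The states reachable from `0` in a given number of steps. -/
def reachableSubmodule (A : Matrix ι ι 𝕜) (B : Matrix ι κ 𝕜) : ℕ → Submodule 𝕜 (ι → 𝕜)
  | 0 => ⊥
  | T + 1 => (reachableSubmodule A B T).map A.mulVecLin ⊔ LinearMap.range B.mulVecLin

variable {A : Matrix ι ι 𝕜} {B : Matrix ι κ 𝕜}

omit [DecidableEq ι] in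
lemma exists_finalState_eq_of_mem_reachableSubmodule {T : ℕ} {x : ι → 𝕜}
    (hx : x ∈ reachableSubmodule A B T) : ∃ us, finalState A B 0 us = x := by
  induction T generalizing x with
  | zero => exact ⟨[], ((Submodule.mem_bot 𝕜).1 hx).symm⟩
  | succ T ih =>
    obtain ⟨_, ⟨y, hy, rfl⟩, _, ⟨u, rfl⟩, rfl⟩ := Submodule.mem_sup.1 hx
    obtain ⟨us, rfl⟩ := ih hy
    exact ⟨us ++ [u], by simp [finalState]⟩

omit [DecidableEq ι] in
lemma reachableSubmodule_mono : Monotone (reachableSubmodule A B) := by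
  refine monotone_nat_of_le_succ fun T => ?_
  induction T with
  | zero => exact bot_le
  | succ T ih => exact sup_le_sup_right (Submodule.map_mono ih) _

lemma pow_mul_mulVec_mem_reachableSubmodule (k : ℕ) (u : κ → 𝕜) :
    (A ^ k * B) *ᵥ u ∈ reachableSubmodule A B (k + 1) := by
  induction k with
  | zero =>
    exact Submodule.mem_sup_right ⟨u, by simp⟩
  | succ k ih =>
    refine Submodule.mem_sup_left ⟨_, ih, ?_⟩
    rw [Matrix.mulVecLin_apply, Matrix.mulVec_mulVec, ← Matrix.mul_assoc, ← pow_succ']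

/-- All states are reachable when no nonzero row vector annihilates all `A ^ k B`. -/
theorem exists_finalState_eq (h : ∀ ξ : ι → 𝕜, (∀ k : ℕ, ξ ᵥ* (A ^ k * B) = 0) → ξ = 0)
    (x : ι → 𝕜) : ∃ us, finalState A B 0 us = x := by
  suffices hx : x ∈ ⨆ T, reachableSubmodule A B T by
    obtain ⟨T, hT⟩ :=
      (Submodule.mem_iSup_of_directed _ reachableSubmodule_mono.directed_le).1 hx
    exact exists_finalState_eq_of_mem_reachableSubmodule hT
  suffices htop : (⨆ T, reachableSubmodule A B T) = ⊤ by rw [htop]; trivial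
  by_contra hne
  -- If the reachable space were proper, a nonzero functional would vanish on it; its row vector
  -- annihilates all `A ^ k B`.
  obtain ⟨f, hf, hle⟩ := Submodule.exists_le_ker_of_lt_top _ (lt_top_iff_ne_top.2 hne)
  refine hf ?_
  have hfx (y : ι → 𝕜) : f y = (fun i => f (Pi.single i 1)) ⬝ᵥ y := by
    conv_lhs => rw [← Finset.univ_sum_single y, map_sum]
    refine Finset.sum_congr rfl fun i _ => ?_
    have : (Pi.single i (y i) : ι → 𝕜) = y i • Pi.single i 1 := by
      ext j; simp [Pi.single_apply]
    rw [this, map_smul, smul_eq_mul, mul_comm]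
  have hξ := h (fun i => f (Pi.single i 1)) fun k => by
    refine dotProduct_eq_zero _ fun u => ?_
    rw [← Matrix.dotProduct_mulVec, ← hfx]
    exact hle (Submodule.mem_iSup_of_mem _ (pow_mul_mulVec_mem_reachableSubmodule k u))
  refine LinearMap.ext fun y => ?_
  rw [hfx, hξ, zero_dotProduct, LinearMap.zero_apply]

omit [Fintype κ] in
/-- Popov-Belevitch-Hautus: over the complex numbers, the eigenvector test implies the
Kalman condition. -/
theorem eq_zero_of_forall_vecMul_pow_mul_eq_zero {A : Matrix ι ι ℂ} {B : Matrix ι κ ℂ}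
    (h : ∀ (z : ℂ) (v : ι → ℂ), v ᵥ* (z • 1 - A) = 0 → v ᵥ* B = 0 → v = 0) {ξ : ι → ℂ}
    (hξ : ∀ k : ℕ, ξ ᵥ* (A ^ k * B) = 0) : ξ = 0 := by
  -- The row vectors violating the Kalman condition form a space invariant under right
  -- multiplication by `A`; if nonzero, it contains a left eigenvector of `A` annihilating `B`.
  let W : Submodule ℂ (ι → ℂ) := ⨅ k : ℕ, LinearMap.ker (A ^ k * B).vecMulLinear
  have hW (v : ι → ℂ) : v ∈ W ↔ ∀ k : ℕ, v ᵥ* (A ^ k * B) = 0 := by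
    simp [W, Submodule.mem_iInf]
  have hinv : ∀ v ∈ W, A.vecMulLinear v ∈ W := fun v hv => by
    rw [hW] at hv ⊢
    intro k
    rw [Matrix.vecMulLinear_apply, Matrix.vecMul_vecMul, ← Matrix.mul_assoc, ← pow_succ']
    exact hv (k + 1)
  by_contra hne
  have : Nontrivial W := ⟨⟨ξ, (hW ξ).2 hξ⟩, 0, fun h0 => hne (congrArg Subtype.val h0)⟩
  obtain ⟨z, hz⟩ := Module.End.exists_eigenvalue (A.vecMulLinear.restrict hinv)
  obtain ⟨⟨v, hv⟩, hev⟩ := hz.exists_hasEigenvector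
  refine hev.2 (Subtype.ext (h z v ?_ ?_))
  · have := congrArg Subtype.val hev.apply_eq_smul
    simp only [LinearMap.restrict_apply, Matrix.vecMulLinear_apply, Submodule.coe_smul] at this
    rw [Matrix.vecMul_sub, this, Matrix.vecMul_smul, Matrix.vecMul_one, sub_self]
  · simpa using (hW v).1 hv 0

end Reachability

/-! ### Passage from `𝕜` to the complex numbers. -/

section Complexification

variable (𝕜 : Type*) [RCLike 𝕜]

/-- The embedding of `𝕜` into the complex numbers. -/
def toComplexHom : 𝕜 →+* ℂ where
  toFun x := (RCLike.re x : ℂ) + (RCLike.im x : ℂ) * Complex.I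
  map_one' := by simp
  map_zero' := by simp
  map_add' x y := by simp only [map_add]; push_cast; ring
  map_mul' x y := by
    simp only [RCLike.mul_re, RCLike.mul_im]
    push_cast
    linear_combination (-(RCLike.im x : ℂ) * RCLike.im y) * Complex.I_mul_I

variable {𝕜} {ι κ μ : Type*}

lemma toComplexHom_star (x : 𝕜) : toComplexHom 𝕜 (star x) = star (toComplexHom 𝕜 x) := by
  simp [toComplexHom]

lemma toComplexHom_re (x : 𝕜) : (toComplexHom 𝕜 x).re = RCLike.re x := by
  simp [toComplexHom]

lemma toComplexMatrix_eq_map (M : Matrix ι κ 𝕜) : toComplexMatrix M = M.map (toComplexHom 𝕜) := rfl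

lemma toComplexMatrix_mul [Fintype κ] (M : Matrix ι κ 𝕜) (N : Matrix κ μ 𝕜) :
    toComplexMatrix (M * N) = toComplexMatrix M * toComplexMatrix N := by
  simp only [toComplexMatrix_eq_map, Matrix.map_mul]

lemma toComplexMatrix_one [DecidableEq ι] : toComplexMatrix (1 : Matrix ι ι 𝕜) = 1 :=
  Matrix.map_one _ (map_zero (toComplexHom 𝕜)) (map_one (toComplexHom 𝕜))

lemma toComplexMatrix_sub (M N : Matrix ι κ 𝕜) :
    toComplexMatrix (M - N) = toComplexMatrix M - toComplexMatrix N :=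
  Matrix.map_sub _ (map_sub (toComplexHom 𝕜)) M N

lemma toComplexMatrix_pow [Fintype ι] [DecidableEq ι] (M : Matrix ι ι 𝕜) (k : ℕ) :
    toComplexMatrix (M ^ k) = toComplexMatrix M ^ k :=
  map_pow (toComplexHom 𝕜).mapMatrix M k

lemma toComplexMatrix_mulVec [Fintype κ] (M : Matrix ι κ 𝕜) (v : κ → 𝕜) :
    toComplexMatrix M *ᵥ (toComplexHom 𝕜 ∘ v) = toComplexHom 𝕜 ∘ (M *ᵥ v) := by
  ext i; exact ((toComplexHom 𝕜).map_mulVec M v i).symm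

lemma vecMul_toComplexMatrix [Fintype ι] (M : Matrix ι κ 𝕜) (v : ι → 𝕜) :
    (toComplexHom 𝕜 ∘ v) ᵥ* toComplexMatrix M = toComplexHom 𝕜 ∘ (v ᵥ* M) := by
  ext i; exact ((toComplexHom 𝕜).map_vecMul M v i).symm

lemma toComplexMatrix_nonsing_inv [Fintype ι] [DecidableEq ι] {M : Matrix ι ι 𝕜} (hM : IsUnit M) :
    toComplexMatrix M⁻¹ = (toComplexMatrix M)⁻¹ := by
  refine (Matrix.inv_eq_right_inv ?_).symm
  rw [← toComplexMatrix_mul, Matrix.mul_nonsing_inv _ ((Matrix.isUnit_iff_isUnit_det _).1 hM),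
    toComplexMatrix_one]

lemma isUnit_det_toComplexMatrix [Fintype ι] [DecidableEq ι] {M : Matrix ι ι 𝕜} (hM : IsUnit M) :
    IsUnit (toComplexMatrix M).det := by
  rw [← Matrix.isUnit_iff_isUnit_det]
  exact hM.map (toComplexHom 𝕜).mapMatrix

end Complexification

/-! ### Hautus condition and transfer function of the standard system. -/

namespace DescriptorSystem

variable {𝕜 : Type*} [RCLike 𝕜] {n m : ℕ} {S : DescriptorSystem 𝕜 n m} {r s : ℕ}

/-- Full row rank makes the rows independent, so there is no left null vector. -/
lemma IsBehaviorallyControllable.eq_zero (hC : S.IsBehaviorallyControllable) (z : ℂ)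
    {v : Fin n → ℂ} (h1 : v ᵥ* S.pencil z = 0) (h2 : v ᵥ* toComplexMatrix S.B = 0) : v = 0 := by
  have hli : LinearIndependent ℂ
      (Matrix.fromCols (S.pencil z) (toComplexMatrix S.B)).row := by
    rw [linearIndependent_iff_card_eq_finrank_span, Fintype.card_fin,
      Set.finrank, ← Matrix.rank_eq_finrank_span_row, hC z]
  refine Matrix.vecMul_injective_iff.2 hli ?_
  simp [Matrix.vecMul_fromCols, h1, h2]

namespace SVD

lemma standardSystem_pencil (R : S.SVD r s) (z : ℂ) :
    R.standardSystem.pencil z = z • 1 - toComplexMatrix R.standardSystem.A := by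
  rw [pencil, ← toComplexMatrix_one (𝕜 := 𝕜)]; rfl

/-- The restricted system equivalence, for the complex pencils. -/
theorem exists_pencil_equivalence (R : S.SVD r s) (hA : IsUnit R.A₂₂) :
    ∃ (L : Matrix (Fin r ⊕ Fin s) (Fin n) ℂ) (L' : Matrix (Fin n) (Fin r ⊕ Fin s) ℂ)
      (K : Matrix (Fin n) (Fin r ⊕ Fin s) ℂ) (K' : Matrix (Fin r ⊕ Fin s) (Fin n) ℂ),
      L' * L = 1 ∧ L * L' = 1 ∧ K * K' = 1 ∧
      (∀ z, L * S.pencil z * K =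
        Matrix.fromBlocks (R.standardSystem.pencil z) 0 0 (-toComplexMatrix R.A₂₂)) ∧
      L * toComplexMatrix S.B =
        Matrix.fromRows (toComplexMatrix R.standardSystem.B) (toComplexMatrix R.B₂) ∧
      toComplexMatrix S.C * K =
        Matrix.fromCols (toComplexMatrix R.standardSystem.C) (toComplexMatrix R.C₂) := by
  obtain ⟨L, L', K, K', h1, h2, hE, hA', hB, hC⟩ := R.exists_restrictedEquivalence hA
  have h1' : toComplexMatrix L' * toComplexMatrix L = 1 := by
    rw [← toComplexMatrix_mul, h1, toComplexMatrix_one]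
  refine ⟨toComplexMatrix L, toComplexMatrix L', toComplexMatrix K, toComplexMatrix K', h1',
    (Matrix.mul_eq_one_comm_of_equiv (blockEquiv R.dim).symm).1 h1', ?_, fun z => ?_, ?_, ?_⟩
  · rw [← toComplexMatrix_mul, h2, toComplexMatrix_one]
  · rw [pencil, Matrix.mul_sub, Matrix.sub_mul, Matrix.mul_smul, Matrix.smul_mul,
      ← toComplexMatrix_mul, ← toComplexMatrix_mul, ← toComplexMatrix_mul, ← toComplexMatrix_mul,
      hE, hA', standardSystem_pencil]
    simp only [toComplexMatrix_eq_map, Matrix.fromBlocks_map, Matrix.fromBlocks_smul,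
      sub_eq_add_neg, Matrix.fromBlocks_neg, Matrix.fromBlocks_add]
    simp
  · rw [← toComplexMatrix_mul, hB]
    exact Matrix.fromRows_map ..
  · rw [← toComplexMatrix_mul, hC]
    exact Matrix.fromCols_map ..

/-- The standard system inherits the Hautus condition. -/
theorem standardSystem_hautus (R : S.SVD r s) (hA : IsUnit R.A₂₂)
    (hC : S.IsBehaviorallyControllable) (z : ℂ) (v : Fin r → ℂ)
    (h1 : v ᵥ* (z • 1 - toComplexMatrix R.standardSystem.A) = 0)
    (h2 : v ᵥ* toComplexMatrix R.standardSystem.B = 0) : v = 0 := by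
  obtain ⟨L, L', K, K', hL1, hL2, hK, hpen, hB, -⟩ := R.exists_pencil_equivalence hA
  rw [← standardSystem_pencil] at h1
  have h3 : (Sum.elim v 0 ᵥ* L) ᵥ* S.pencil z = 0 := by
    have : (Sum.elim v 0 : Fin r ⊕ Fin s → ℂ) ᵥ* (L * S.pencil z * K) = 0 := by
      rw [hpen, Matrix.vecMul_fromBlocks]
      simp [h1]
    rw [← Matrix.vecMul_vecMul, ← Matrix.vecMul_vecMul] at this
    have := congrArg (· ᵥ* K') this
    simpa [Matrix.vecMul_vecMul, Matrix.mul_assoc, hK] using this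
  have h4 : (Sum.elim v 0 ᵥ* L) ᵥ* toComplexMatrix S.B = 0 := by
    rw [Matrix.vecMul_vecMul, hB, Matrix.vecMul_fromRows]
    simp [h2]
  have h5 := congrArg (· ᵥ* L') (hC.eq_zero z h3 h4)
  simp only [Matrix.vecMul_vecMul, hL2, Matrix.vecMul_one, Matrix.zero_vecMul] at h5
  ext i
  exact congrFun h5 (Sum.inl i)

/-- The transfer function is that of the standard system. -/
theorem transfer_eq (R : S.SVD r s) (hA : IsUnit R.A₂₂) {z : ℂ}
    (hz : z ∈ R.standardSystem.resolventSet) :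
    z ∈ S.resolventSet ∧ S.transfer z = R.standardSystem.transfer z := by
  obtain ⟨L, L', K, K', hL1, hL2, hK, hpen, hB, hC⟩ := R.exists_pencil_equivalence hA
  have hA' := isUnit_det_toComplexMatrix hA
  have hz' : IsUnit (R.standardSystem.pencil z).det := isUnit_iff_ne_zero.2 hz
  -- The inverse of the block-diagonal pencil; undoing the equivalence, `K * G * L` inverts `z E -
  -- A`. Its constant block contributes exactly the correction term in `𝒟`.
  let G : Matrix (Fin r ⊕ Fin s) (Fin r ⊕ Fin s) ℂ :=
    Matrix.fromBlocks (R.standardSystem.pencil z)⁻¹ 0 0 (-(toComplexMatrix R.A₂₂)⁻¹)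
  have hG : L * S.pencil z * K * G = 1 := by
    rw [hpen, Matrix.fromBlocks_multiply]
    simp [Matrix.mul_nonsing_inv _ hA', Matrix.mul_nonsing_inv _ hz']
  have hright : S.pencil z * (K * G * L) = 1 := by
    calc S.pencil z * (K * G * L) = L' * L * (S.pencil z * (K * G * L)) := by
          rw [hL1, Matrix.one_mul]
      _ = L' * (L * S.pencil z * K * G) * L := by simp only [Matrix.mul_assoc]
      _ = 1 := by rw [hG, Matrix.mul_one, hL1]
  have hdet : IsUnit (S.pencil z).det := Matrix.isUnit_det_of_right_inverse hright
  refine ⟨hdet.ne_zero, ?_⟩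
  rw [transfer, transfer, Matrix.inv_eq_right_inv hright]
  have : toComplexMatrix S.C * (K * G * L) * toComplexMatrix S.B =
      toComplexMatrix R.standardSystem.C * (R.standardSystem.pencil z)⁻¹ *
        toComplexMatrix R.standardSystem.B -
      toComplexMatrix (R.C₂ * R.A₂₂⁻¹ * R.B₂) := by
    calc toComplexMatrix S.C * (K * G * L) * toComplexMatrix S.B
        = (toComplexMatrix S.C * K) * G * (L * toComplexMatrix S.B) := by
          simp only [Matrix.mul_assoc]
      _ = _ := by
          rw [hC, hB, Matrix.fromCols_mul_fromBlocks, Matrix.fromCols_mul_fromRows,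
            toComplexMatrix_mul, toComplexMatrix_mul, toComplexMatrix_nonsing_inv hA]
          simp [sub_eq_add_neg]
  rw [this, standardSystem, toComplexMatrix_sub]
  abel

end SVD

end DescriptorSystem

/-! ### Trajectories as power series in `w = 1/z`. -/

section Frequency

open Metric Asymptotics ComplexConjugate

variable {ι κ : Type*} [Fintype ι] [DecidableEq ι] [Fintype κ]

lemma eventually_det_one_sub_smul_ne_zero (A : Matrix ι ι ℂ) :
    ∀ᶠ w : ℂ in 𝓝 0, (1 - w • A).det ≠ 0 := by
  have hc : Continuous fun w : ℂ => (1 - w • A).det := by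
    refine Continuous.matrix_det ?_
    fun_prop
  exact hc.continuousAt.eventually_ne (by simp)

lemma continuousAt_inv_one_sub_smul (A : Matrix ι ι ℂ) :
    ContinuousAt (fun w : ℂ => (1 - w • A)⁻¹) 0 := by
  have hc : Continuous fun w : ℂ => 1 - w • A := by fun_prop
  simp only [Matrix.inv_def, Ring.inverse_eq_inv']
  exact (hc.matrix_det.continuousAt.inv₀ (by simp)).smul hc.matrix_adjugate.continuousAt

/-- The generating function of the states up to a finite time. -/
lemma one_sub_smul_mulVec_sum (A : Matrix ι ι ℂ) (B : Matrix ι κ ℂ) {x : ℕ → ι → ℂ}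
    {u : ℕ → κ → ℂ} (h0 : x 0 = 0) {N : ℕ} (hx : ∀ k < N, x (k + 1) = A *ᵥ x k + B *ᵥ u k)
    (w : ℂ) :
    (1 - w • A) *ᵥ ∑ k ∈ Finset.range N, w ^ k • x k =
      w • B *ᵥ (∑ k ∈ Finset.range N, w ^ k • u k) - w ^ N • x N := by
  induction N with
  | zero => simp [h0]
  | succ N ih =>
    rw [Finset.sum_range_succ, Finset.sum_range_succ, Matrix.mulVec_add, Matrix.mulVec_add,
      ih fun k hk => hx k (by omega), hx N (by omega)]
    simp only [Matrix.sub_mulVec, Matrix.one_mulVec, Matrix.smul_mulVec, Matrix.mulVec_smul,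
      smul_add, smul_sub, smul_smul, pow_succ']
    rw [mul_comm (w ^ N) w]
    abel

/-- **Dissipativity in the time domain**: if `G` is an analytic extension to `|z| > 1` of the
transfer function `C (z - A)⁻¹ B + D` along which the supply rate is nonnegative, the supply along
any trajectory from the zero state is nonnegative. -/
theorem sum_supplyRate_nonneg_of_transfer (α β : ℝ) {γ : ℝ} (hγ : 0 ≤ γ)
    (A : Matrix ι ι ℂ) (B : Matrix ι κ ℂ) (C : Matrix κ ι ℂ) (D : Matrix κ κ ℂ)
    {G : ℂ → Matrix κ κ ℂ}
    (hG : ∀ i j, AnalyticOnNhd ℂ (fun z => G z i j) {z : ℂ | 1 < ‖z‖})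
    (hGt : ∀ z : ℂ, 1 < ‖z‖ → (z • 1 - A).det ≠ 0 → G z = C * (z • 1 - A)⁻¹ * B + D)
    (hpos : ∀ z : ℂ, 1 < ‖z‖ → ∀ v, 0 ≤ ∑ i, supplyRate α β γ (v i) ((G z *ᵥ v) i))
    {x : ℕ → ι → ℂ} {u : ℕ → κ → ℂ} (h0 : x 0 = 0) {N : ℕ}
    (hx : ∀ k < N, x (k + 1) = A *ᵥ x k + B *ᵥ u k) :
    0 ≤ ∑ k ∈ Finset.range N, ∑ i, supplyRate α β γ (u k i) ((C *ᵥ x k + D *ᵥ u k) i) := by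
  classical
  -- `D` is the value of the transfer function at infinity. The resolvent formula is used only near
  -- `w = 0`, as `A` may have eigenvalues outside the unit disc; elsewhere the analyticity of `G`
  -- suffices.
  let F : ℂ → Matrix κ κ ℂ := fun w => if w = 0 then D else G w⁻¹
  have hinv (w : ℂ) (hw : w ≠ 0) (hw1 : ‖w‖ < 1) : 1 < ‖w⁻¹‖ := by
    rw [norm_inv]; exact (one_lt_inv₀ (norm_pos_iff.2 hw)).2 hw1
  have hball : ball (0 : ℂ) 1 ∈ 𝓝 0 := ball_mem_nhds _ one_pos
  have hFev : ∀ᶠ w in 𝓝 0, F w = D + w • (C * (1 - w • A)⁻¹ * B) := by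
    filter_upwards [eventually_det_one_sub_smul_ne_zero A, hball] with w hdet hw1
    rcases eq_or_ne w 0 with rfl | hw
    · simp [F]
    have hfac : w⁻¹ • 1 - A = w⁻¹ • (1 - w • A) := by
      rw [smul_sub, smul_smul, inv_mul_cancel₀ hw, one_smul]
    have hdet' : (w⁻¹ • 1 - A).det ≠ 0 := by
      rw [hfac, Matrix.det_smul]
      exact mul_ne_zero (pow_ne_zero _ (inv_ne_zero hw)) hdet
    have hI : (w⁻¹ • 1 - A)⁻¹ = w • (1 - w • A)⁻¹ := by
      refine Matrix.inv_eq_right_inv ?_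
      rw [hfac, Matrix.smul_mul, Matrix.mul_smul, smul_smul, inv_mul_cancel₀ hw, one_smul,
        Matrix.mul_nonsing_inv _ (isUnit_iff_ne_zero.2 hdet)]
    simp only [F, if_neg hw]
    rw [hGt _ (hinv w hw (by simpa using hw1)) hdet', hI, Matrix.mul_smul, Matrix.smul_mul,
      add_comm]
  have hFdiff (i j : κ) : DifferentiableOn ℂ (fun w => F w i j) (ball 0 1) := by
    -- Removable singularity at 0: only continuity has to be checked there.
    rw [← Complex.differentiableOn_compl_singleton_and_continuousAt_iff hball]
    refine ⟨fun w hw => ?_, ?_⟩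
    · have hw0 : w ≠ 0 := hw.2
      have h1 : DifferentiableAt ℂ (fun z => G z i j) w⁻¹ :=
        (hG i j _ (hinv w hw0 (by simpa using hw.1))).differentiableAt
      have h2 : DifferentiableAt ℂ (fun w => G w⁻¹ i j) w :=
        h1.comp w (differentiableAt_inv hw0)
      refine (h2.congr_of_eventuallyEq ?_).differentiableWithinAt
      filter_upwards [isOpen_ne.mem_nhds hw0] with t ht
      have ht : t ≠ 0 := ht
      simp [F, ht]
    · have h1 : ContinuousAt (fun w : ℂ => D + w • (C * (1 - w • A)⁻¹ * B)) 0 := by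
        have := continuousAt_inv_one_sub_smul A
        refine continuousAt_const.add (continuousAt_id.smul ?_)
        have hc : Continuous fun M : Matrix ι ι ℂ => C * M * B := by fun_prop
        exact hc.continuousAt.comp this
      have h2 : ContinuousAt (fun w : ℂ => (D + w • (C * (1 - w • A)⁻¹ * B)) i j) 0 :=
        continuousAt_pi.1 (continuousAt_pi.1 h1 i) j
      refine h2.congr ?_
      filter_upwards [hFev] with w hw
      rw [hw]
  let U : ℂ → κ → ℂ := fun w => ∑ k ∈ Finset.range N, w ^ k • u k
  have hU (w : ℂ) (i : κ) : U w i = ∑ k ∈ Finset.range N, u k i * w ^ k := by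
    simp [U, Finset.sum_apply, mul_comm]
  refine sum_supplyRate_nonneg α β hγ N (fun i k => u k i) (fun i k => (C *ᵥ x k + D *ᵥ u k) i)
    (fun i w => (F w *ᵥ U w) i) (fun i => ?_) (fun i => ?_) fun w hw hw1 => ?_
  · simp only [Matrix.mulVec, dotProduct, hU]
    refine DifferentiableOn.fun_sum fun j _ => (hFdiff i j).mul ?_
    fun_prop
  -- The remainder is the response after time `N` with zero input, started from `x N`; hence it is
  -- `O(w ^ N)`.
  · have hdiff : ∀ᶠ w in 𝓝 0, (F w *ᵥ U w) i -
        ∑ k ∈ Finset.range N, (C *ᵥ x k + D *ᵥ u k) i * w ^ k =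
          w ^ N * ((C * (1 - w • A)⁻¹) *ᵥ x N) i := by
      filter_upwards [hFev, eventually_det_one_sub_smul_ne_zero A] with w hF hdet
      have hu := isUnit_iff_ne_zero.2 hdet
      have hX := congrArg ((1 - w • A)⁻¹ *ᵥ ·) (one_sub_smul_mulVec_sum A B h0 hx w)
      simp only [Matrix.mulVec_mulVec, Matrix.nonsing_inv_mul _ hu, Matrix.one_mulVec] at hX
      have hp : ∑ k ∈ Finset.range N, (C *ᵥ x k + D *ᵥ u k) i * w ^ k =
          (C *ᵥ (∑ k ∈ Finset.range N, w ^ k • x k) + D *ᵥ U w) i := by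
        simp only [U, Matrix.mulVec_sum, Matrix.mulVec_smul, ← Finset.sum_add_distrib,
          Finset.sum_apply, ← smul_add, Pi.smul_apply, smul_eq_mul]
        exact Finset.sum_congr rfl fun k _ => mul_comm _ _
      rw [hp, hX, hF]
      refine congrFun (?_ : _ - (_ + _) = w ^ N • ((C * (1 - w • A)⁻¹) *ᵥ x N)) i
      simp only [Matrix.add_mulVec, Matrix.mulVec_sub, Matrix.smul_mulVec, Matrix.mulVec_smul,
        Matrix.mulVec_mulVec, Matrix.mul_assoc]
      simp only [U]
      abel
    have hbd : (fun w : ℂ => ((C * (1 - w • A)⁻¹) *ᵥ x N) i) =O[𝓝 0] fun _ => (1 : ℂ) := by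
      have h1 : ContinuousAt (fun w : ℂ => (C * (1 - w • A)⁻¹) *ᵥ x N) 0 :=
        (by fun_prop : Continuous fun M : Matrix ι ι ℂ => (C * M) *ᵥ x N).continuousAt.comp
          (continuousAt_inv_one_sub_smul A)
      exact (continuousAt_pi.1 h1 i).tendsto.isBigO_one ℂ
    have h2 := (isBigO_refl (fun w : ℂ => w ^ N) (𝓝 0)).mul hbd
    simp only [mul_one] at h2
    exact (h2.congr' (hdiff.mono fun w hw => hw.symm) EventuallyEq.rfl).mono nhdsWithin_le_nhds
  · have := hpos w⁻¹ (hinv w hw hw1) (U w)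
    simpa only [F, if_neg hw, hU] using this

end Frequency

/-! ### The KYP lemma for a general supply rate. -/

section KYP

variable {𝕜 : Type*} [RCLike 𝕜] {ι κ : Type*} [Fintype ι] [Fintype κ] [DecidableEq κ]

/-- The matrix of the supply rate `α |u|² + 2 β Re (uᴴ y) - γ |y|²` in the pair `(u, y)`. -/
def supplyMatrix (𝕜 : Type*) [RCLike 𝕜] (κ : Type*) [DecidableEq κ] (α β γ : ℝ) :
    Matrix (κ ⊕ κ) (κ ⊕ κ) 𝕜 :=
  Matrix.fromBlocks ((α : 𝕜) • 1) ((β : 𝕜) • 1) ((β : 𝕜) • 1) (-((γ : 𝕜) • 1))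

omit [Fintype κ] in
lemma supplyMatrix_isHermitian (α β γ : ℝ) : (supplyMatrix 𝕜 κ α β γ).IsHermitian := by
  rw [supplyMatrix, Matrix.isHermitian_fromBlocks_iff]
  refine ⟨?_, ?_, ?_, ?_⟩ <;>
    simp [Matrix.IsHermitian, Matrix.conjTranspose_smul]

/-- The matrix of `(x, u) ↦ (u, C x + D u)`. -/
def inputOutputMatrix (C : Matrix κ ι 𝕜) (D : Matrix κ κ 𝕜) : Matrix (κ ⊕ κ) (ι ⊕ κ) 𝕜 :=
  Matrix.fromBlocks 0 1 C D

lemma supplyMatrix_reForm (α β γ : ℝ) (u y : κ → 𝕜) :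
    (supplyMatrix 𝕜 κ α β γ).reForm (Sum.elim u y) =
      ∑ i, supplyRate α β γ (toComplexHom 𝕜 (u i)) (toComplexHom 𝕜 (y i)) := by
  have h (a b : 𝕜) : RCLike.re (star b * a) = RCLike.re (star a * b) := by
    rw [← RCLike.conj_re (star b * a)]; simp [mul_comm]
  have hs (a b : 𝕜) : (starRingEnd ℂ) (toComplexHom 𝕜 a) * toComplexHom 𝕜 b =
      toComplexHom 𝕜 (star a * b) := by
    rw [map_mul, toComplexHom_star]; rfl
  have hr (i : κ) : supplyRate α β γ (toComplexHom 𝕜 (u i)) (toComplexHom 𝕜 (y i)) =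
      α * RCLike.re (star (u i) * u i) + 2 * β * RCLike.re (star (u i) * y i) -
        γ * RCLike.re (star (y i) * y i) := by
    rw [supplyRate, hs, hs, hs, ← toComplexHom_re, ← toComplexHom_re, ← toComplexHom_re]
    simp
  simp only [hr, Matrix.reForm, supplyMatrix, Matrix.fromBlocks_mulVec, Function.star_sumElim,
    Sum.elim_comp_inl, Sum.elim_comp_inr, Matrix.smul_mulVec, Matrix.neg_mulVec,
    Matrix.one_mulVec, sumElim_dotProduct_sumElim, dotProduct_add, dotProduct_smul,
    dotProduct_neg, smul_eq_mul, map_add, map_neg, RCLike.re_ofReal_mul]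
  simp only [dotProduct, map_sum, Pi.star_apply, Finset.mul_sum, ← Finset.sum_add_distrib,
    ← Finset.sum_neg_distrib]
  refine Finset.sum_congr rfl fun i _ => ?_
  rw [h (u i) (y i)]
  ring

omit [Fintype ι] [Fintype κ] [DecidableEq κ] in
lemma cumulativeSupply_eq_sum [Fintype ι] [Fintype κ] {A : Matrix ι ι 𝕜} {B : Matrix ι κ 𝕜}
    {M : Matrix (ι ⊕ κ) (ι ⊕ κ) 𝕜} (x : ι → 𝕜) (us : List (κ → 𝕜)) :
    cumulativeSupply A B M x us = ∑ k ∈ Finset.range us.length,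
      M.reForm (Sum.elim (finalState A B x (us.take k)) (us.getD k 0)) := by
  induction us generalizing x with
  | nil => simp [cumulativeSupply]
  | cons u us ih =>
    rw [cumulativeSupply, ih, List.length_cons, Finset.sum_range_succ', add_comm]
    rfl

variable [DecidableEq ι]

/-- **Discrete-time KYP lemma** for a controllable, not necessarily observable, system. -/
theorem exists_posSemidef_dissipation (α β : ℝ) {γ : ℝ} (hγ : 0 ≤ γ)
    (A : Matrix ι ι 𝕜) (B : Matrix ι κ 𝕜) (C : Matrix κ ι 𝕜) (D : Matrix κ κ 𝕜)
    (hctrl : ∀ (z : ℂ) (v : ι → ℂ), v ᵥ* (z • 1 - toComplexMatrix A) = 0 →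
      v ᵥ* toComplexMatrix B = 0 → v = 0)
    {G : ℂ → Matrix κ κ ℂ}
    (hG : ∀ i j, AnalyticOnNhd ℂ (fun z => G z i j) {z : ℂ | 1 < ‖z‖})
    (hGt : ∀ z : ℂ, 1 < ‖z‖ → (z • 1 - toComplexMatrix A).det ≠ 0 →
      G z = toComplexMatrix C * (z • 1 - toComplexMatrix A)⁻¹ * toComplexMatrix B +
        toComplexMatrix D)
    (hpos : ∀ z : ℂ, 1 < ‖z‖ → ∀ v, 0 ≤ ∑ i, supplyRate α β γ (v i) ((G z *ᵥ v) i)) :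
    ∃ X : Matrix ι ι 𝕜, X.PosSemidef ∧
      (Matrix.fromBlocks (X - Aᴴ * X * A) (-(Aᴴ * X * B)) (-(Bᴴ * X * A)) (-(Bᴴ * X * B)) +
        (inputOutputMatrix C D)ᴴ * supplyMatrix 𝕜 κ α β γ * inputOutputMatrix C D).PosSemidef := by
  have hM := Matrix.isHermitian_conjTranspose_mul_mul (inputOutputMatrix C D)
    (supplyMatrix_isHermitian (𝕜 := 𝕜) (κ := κ) α β γ)
  set M := (inputOutputMatrix C D)ᴴ * supplyMatrix 𝕜 κ α β γ * inputOutputMatrix C D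
  have hMre (x : ι → 𝕜) (u : κ → 𝕜) : M.reForm (Sum.elim x u) =
      ∑ i, supplyRate α β γ (toComplexHom 𝕜 (u i))
        (toComplexHom 𝕜 ((C *ᵥ x + D *ᵥ u) i)) := by
    rw [Matrix.reForm_conjTranspose_mul_mul, inputOutputMatrix, Matrix.fromBlocks_mulVec,
      ← supplyMatrix_reForm]
    simp
  -- With zero input only `-γ|y|²` remains.
  have hzero (x : ι → 𝕜) : M.reForm (Sum.elim x 0) ≤ 0 := by
    rw [hMre]
    refine Finset.sum_nonpos fun i _ => ?_
    simp only [supplyRate, Pi.zero_apply, map_zero, mul_zero, zero_mul, add_zero, zero_sub,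
      Complex.neg_re, Complex.re_ofReal_mul, Complex.conj_mul', neg_nonpos, ← Complex.ofReal_pow,
      Complex.ofReal_re]
    positivity
  have hsupply (us : List (κ → 𝕜)) : 0 ≤ cumulativeSupply A B M 0 us := by
    rw [cumulativeSupply_eq_sum]
    have h := sum_supplyRate_nonneg_of_transfer α β hγ (toComplexMatrix A) (toComplexMatrix B)
      (toComplexMatrix C) (toComplexMatrix D) hG hGt hpos
      (x := fun k => toComplexHom 𝕜 ∘ finalState A B 0 (us.take k))
      (u := fun k => toComplexHom 𝕜 ∘ us.getD k 0) (N := us.length)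
      (by ext i; simp [finalState]) fun k hk => by
        have hstep : finalState A B 0 (us.take (k + 1)) =
            A *ᵥ finalState A B 0 (us.take k) + B *ᵥ us[k] := by
          rw [List.take_succ_eq_append_getElem hk]
          simp only [finalState, List.foldl_append, List.foldl_cons, List.foldl_nil]
        rw [toComplexMatrix_mulVec, toComplexMatrix_mulVec, hstep, List.getD_eq_getElem _ _ hk]
        ext i; simp
    refine h.trans_eq (Finset.sum_congr rfl fun k _ => ?_)
    rw [hMre]
    refine Finset.sum_congr rfl fun i _ => ?_
    rw [toComplexMatrix_mulVec, toComplexMatrix_mulVec]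
    simp
  have hkalman (ξ : ι → 𝕜) (hξ : ∀ k : ℕ, ξ ᵥ* (A ^ k * B) = 0) : ξ = 0 := by
    have h := eq_zero_of_forall_vecMul_pow_mul_eq_zero hctrl (ξ := toComplexHom 𝕜 ∘ ξ)
      fun k => by
        rw [← toComplexMatrix_pow, ← toComplexMatrix_mul, vecMul_toComplexMatrix, hξ k]
        ext i; simp
    ext i
    have := congrFun h i
    exact (map_eq_zero _).1 this
  obtain ⟨X, hX, hdiss⟩ := exists_storageFunction hM hzero hsupply (exists_finalState_eq hkalman)
  refine ⟨X, hX, Matrix.IsHermitian.posSemidef_of_reForm_nonneg ?_ fun v => ?_⟩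
  · refine Matrix.IsHermitian.add ?_ hM
    rw [Matrix.isHermitian_fromBlocks_iff]
    refine ⟨hX.1.sub (Matrix.isHermitian_conjTranspose_mul_mul A hX.1), ?_, ?_,
      (Matrix.isHermitian_conjTranspose_mul_mul B hX.1).neg⟩ <;>
    simp [Matrix.conjTranspose_mul, hX.1.eq, Matrix.mul_assoc]
  · have hsplit : Matrix.fromBlocks (X - Aᴴ * X * A) (-(Aᴴ * X * B)) (-(Bᴴ * X * A))
        (-(Bᴴ * X * B)) = Matrix.fromBlocks X 0 0 0 -
          (Matrix.fromCols A B)ᴴ * X * Matrix.fromCols A B := by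
      rw [Matrix.conjTranspose_fromCols_eq_fromRows_conjTranspose, Matrix.fromRows_mul,
        Matrix.fromRows_mul_fromCols]
      ext (i | i) (j | j) <;> simp
    obtain ⟨x, u, rfl⟩ : ∃ x u, v = Sum.elim x u :=
      ⟨_, _, (Sum.elim_comp_inl_inr v).symm⟩
    have hXe : (Matrix.fromBlocks X 0 0 0 : Matrix (ι ⊕ κ) (ι ⊕ κ) 𝕜).reForm (Sum.elim x u) =
        X.reForm x := by
      simp [Matrix.reForm, Matrix.fromBlocks_mulVec, Function.star_sumElim]
    rw [Matrix.reForm_add, hsplit, Matrix.reForm_sub, hXe, Matrix.reForm_conjTranspose_mul_mul,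
      Matrix.fromCols_mulVec_sumElim]
    linarith [hdiss x u]

omit [DecidableEq κ] in
-- `vᴴ (G + Gᴴ) v = 2 Re(vᴴ G v)`.
lemma sum_supplyRate_impedance (G : Matrix κ κ ℂ) (hG : (G + Gᴴ).PosSemidef) (v : κ → ℂ) :
    0 ≤ ∑ i, supplyRate 0 1 0 (v i) ((G *ᵥ v) i) := by
  refine (hG.reForm_nonneg v).trans_eq ?_
  have h2 : RCLike.re (star v ⬝ᵥ Gᴴ *ᵥ v) = RCLike.re (star v ⬝ᵥ G *ᵥ v) := by
    rw [Matrix.dotProduct_mulVec, ← Matrix.star_mulVec, Matrix.star_dotProduct]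
    simp
  rw [Matrix.reForm_add, Matrix.reForm, Matrix.reForm, h2]
  simp [dotProduct, supplyRate, ← two_mul, Finset.mul_sum]

lemma sum_supplyRate_scattering (G : Matrix κ κ ℂ) (hG : (1 - Gᴴ * G).PosSemidef) (v : κ → ℂ) :
    0 ≤ ∑ i, supplyRate 1 0 1 (v i) ((G *ᵥ v) i) := by
  refine (hG.reForm_nonneg v).trans_eq ?_
  rw [Matrix.reForm_sub, Matrix.reForm, Matrix.reForm, ← Matrix.mulVec_mulVec,
    Matrix.dotProduct_mulVec _ Gᴴ, ← Matrix.star_mulVec]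
  simp [dotProduct, supplyRate, Finset.sum_sub_distrib]

end KYP

end

/-! ### The two KYP inequalities for the standard system. -/

theorem mainTheorem8 {𝕜 : Type*} [RCLike 𝕜] {n m : ℕ} (S : DescriptorSystem 𝕜 n m)
    (hS : S.StandingAssumption) (hC : S.IsBehaviorallyControllable)
    {r s : ℕ} (R : S.SVD r s) :
    IsUnit R.A₂₂ ∧
    (S.SatisfiesDPR → R.standardSystem.SatisfiesDIKYP) ∧
    (S.SatisfiesDBR → R.standardSystem.SatisfiesDSKYP) := by
  have hA := R.isUnit_A₂₂ hS.index_le_one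
  have hctrl := R.standardSystem_hautus hA hC
  have htransfer {G : ℂ → Matrix (Fin m) (Fin m) ℂ}
      (hG : ∀ z : ℂ, 1 < ‖z‖ → z ∈ S.resolventSet → G z = S.transfer z) (z : ℂ) (hz : 1 < ‖z‖)
      (hdet : (z • 1 - toComplexMatrix R.standardSystem.A).det ≠ 0) :
      G z = toComplexMatrix R.standardSystem.C *
        (z • 1 - toComplexMatrix R.standardSystem.A)⁻¹ * toComplexMatrix R.standardSystem.B +
          toComplexMatrix R.standardSystem.D := by
    rw [← R.standardSystem_pencil] at hdet ⊢
    obtain ⟨h1, h2⟩ := R.transfer_eq hA hdet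
    rw [hG z hz h1, h2, DescriptorSystem.transfer]
  have hE : R.standardSystem.E = 1 := rfl
  refine ⟨hA, fun ⟨G, hG, han, hpos⟩ => ?_, fun ⟨G, hG, han, hpos⟩ => ?_⟩
  · obtain ⟨X, hX, h⟩ := exists_posSemidef_dissipation 0 1 le_rfl R.standardSystem.A
      R.standardSystem.B R.standardSystem.C R.standardSystem.D hctrl han (htransfer hG)
      fun z hz v => sum_supplyRate_impedance (G z) (hpos z hz) v
    refine ⟨X, hX, ?_⟩
    -- Expanding the supply matrix in the pair `(x, u)` gives the stated blocks, with `E = 1`.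
    convert h using 1
    rw [inputOutputMatrix, supplyMatrix, Matrix.fromBlocks_conjTranspose, Matrix.fromBlocks_multiply,
      Matrix.fromBlocks_multiply, Matrix.fromBlocks_add, hE]
    simp [sub_eq_add_neg, add_comm]
  · obtain ⟨X, hX, h⟩ := exists_posSemidef_dissipation 1 0 zero_le_one R.standardSystem.A
      R.standardSystem.B R.standardSystem.C R.standardSystem.D hctrl han (htransfer hG)
      fun z hz v => sum_supplyRate_scattering (G z) (hpos z hz) v
    refine ⟨X, hX, ?_⟩
    convert h using 1
    rw [inputOutputMatrix, supplyMatrix, Matrix.fromBlocks_conjTranspose, Matrix.fromBlocks_multiply,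
      Matrix.fromBlocks_multiply, Matrix.fromBlocks_add, hE]
    simp [sub_eq_add_neg, add_comm]
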